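/- Consider the planar piecewise linear near-Hamiltonian system with three zones $$\dot x = H_y(x,y)+\epsilon f(x,y),\qquad \dot y=-H_x(x,y)+\epsilon g(x,y),$$ where, for the parameters $a_L=b_L=b_R=c_R=1$, $a_R=c_L=0$, $\beta_L=2$, $\beta_R=-2$ of the normal form $H^L=\frac{b_L}{2}y^2-\frac{c_L}{2}x^2+a_Lxy+a_Ly-\beta_Lx$, $H^C=\frac12x^2+\frac12y^2$, $H^R=\frac{b_R}{2}y^2-\frac{c_R}{2}x^2+a_Rxy-a_Ry-\beta_Rx$, $$H(x,y)=\begin{cases}H^L=\frac12y^2+xy+y-2x,& x\le -1,\\ H^C=\frac12x^2+\frac12y^2,&-1\le x\le 1,\\ H^R=\frac12y^2-\frac12x^2+2x,&x\ge 1,\end{cases}$$ and where $f=p_ix+q_iy+r_i$, $g=s_ix+u_iy+v_i$ in the zone $i\in\{L,C,R\}$, with real coefficients. (The unperturbed left and right subsystems have saddles and the central one has a center.) Trajectories are concatenations of solutions of the three subsystems in their closed zones. A periodic orbit is the image of a nonconstant periodic trajectory; it is crossing if at each of its points on $x=\pm1$ the first components of the two adjacent vector fields are nonzero with the same sign. A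 limit cycle is a crossing periodic orbit $\Gamma$ having an open neighbourhood in which $\Gamma$ is the only periodic orbit. For every $h\in(0,1)$ the unperturbed system ($\epsilon=0$) has a crossing periodic orbit $L_h$ through $(1,h)$ visiting the three open zones. Moreover, the coefficients of $f$ and $g$ can be chosen such that for all sufficiently small $\epsilon>0$ the system has at least three limit cycles, each visiting the three zones, which bifurcate from this periodic annulus: there are $0<h_1<h_2<h_3<1$ such that for every $\delta>0$ there is $\epsilon_0>0$ such that for every $0<\epsilon<\epsilon_0$ the system has three distinct limit cycles $\Gamma_1,\Gamma_2,\Gamma_3$, each visiting the three open zones, with $\Gamma_i$ contained in the $\delta$-neighbourhood of $L_{h_i}$ for $i=1,2,3$. -/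

import Mathlib

open Set

namespace PiecewiseHam

/-- The three zones: left (`x ≤ -1`), central (`-1 ≤ x ≤ 1`), right (`1 ≤ x`). -/
inductive Zone
  | L
  | C
  | R

/-- The closed zones, on which the three subsystems are given. -/
def Zone.closedRegion : Zone → Set (ℝ × ℝ)
  | .L => {z | z.1 ≤ -1}
  | .C => {z | -1 ≤ z.1 ∧ z.1 ≤ 1}
  | .R => {z | 1 ≤ z.1}

/-- The open zones. -/
def Zone.openRegion : Zone → Set (ℝ × ℝ)
  | .L => {z | z.1 < -1}
  | .C => {z | -1 < z.1 ∧ z.1 < 1}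
  | .R => {z | 1 < z.1}

/-- Coefficients of a quadratic Hamiltonian. -/
structure QuadHam where
  a : ℝ
  b : ℝ
  c : ℝ
  α : ℝ
  β : ℝ

/-- The Hamiltonian `b/2 y² - c/2 x² + a x y + α y - β x`. -/
noncomputable def QuadHam.val (K : QuadHam) (x y : ℝ) : ℝ :=
  K.b / 2 * y ^ 2 - K.c / 2 * x ^ 2 + K.a * x * y + K.α * y - K.β * x

/-- The Hamiltonian in normal form: in the central zone it is `x²/2 + y²/2`, and `α = a` on the
left, `α = -a` on the right. -/
def normalForm (aL bL cL βL aR bR cR βR : ℝ) : Zone → QuadHam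
  | .L => { a := aL, b := bL, c := cL, α := aL, β := βL }
  | .C => { a := 0, b := 1, c := -1, α := 0, β := 0 }
  | .R => { a := aR, b := bR, c := cR, α := -aR, β := βR }

/-- Coefficients of an affine perturbation `f = p x + q y + r`, `g = s x + u y + v`. -/
structure AffinePert where
  p : ℝ
  q : ℝ
  r : ℝ
  s : ℝ
  u : ℝ
  v : ℝ

def AffinePert.f (P : AffinePert) (x y : ℝ) : ℝ := P.p * x + P.q * y + P.r

def AffinePert.g (P : AffinePert) (x y : ℝ) : ℝ := P.s * x + P.u * y + P.v

/-- The unperturbed piecewise vector field `(H_y, -H_x)`; the subsystem of the zone `Z` is its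
value at `Z`, an affine vector field on the whole plane. -/
noncomputable def hamField (H : Zone → QuadHam) (Z : Zone) (z : ℝ × ℝ) : ℝ × ℝ :=
  (deriv (fun y => (H Z).val z.1 y) z.2, -deriv (fun x => (H Z).val x z.2) z.1)

/-- The perturbed piecewise vector field `(H_y + ε f, -H_x + ε g)`. -/
noncomputable def pertField (H : Zone → QuadHam) (P : Zone → AffinePert) (ε : ℝ)
    (Z : Zone) (z : ℝ × ℝ) : ℝ × ℝ :=
  hamField H Z z + ε • ((P Z).f z.1 z.2, (P Z).g z.1 z.2)

/-- On `[s, t]` the curve `γ` stays in the closed zone `Z` and solves the subsystem of `Z`. -/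
def IsArc (X : Zone → ℝ × ℝ → ℝ × ℝ) (Z : Zone) (γ : ℝ → ℝ × ℝ) (s t : ℝ) : Prop :=
  ∀ τ ∈ Icc s t, γ τ ∈ Z.closedRegion ∧ HasDerivWithinAt γ (X Z (γ τ)) (Icc s t) τ

/-- A trajectory of the piecewise system, defined for all times: a concatenation of arcs, i.e.
just after and just before each time the curve follows one of the subsystems inside its zone.
(Continuity follows from the existence of both one-sided derivatives.) -/
def IsTrajectory (X : Zone → ℝ × ℝ → ℝ × ℝ) (γ : ℝ → ℝ × ℝ) : Prop :=
  ∀ t : ℝ, (∃ δ > 0, ∃ Z, IsArc X Z γ t (t + δ)) ∧ (∃ δ > 0, ∃ Z, IsArc X Z γ (t - δ) t)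

/-- A periodic orbit: the image of a nonconstant periodic trajectory. -/
def IsPeriodicOrbit (X : Zone → ℝ × ℝ → ℝ × ℝ) (Γ : Set (ℝ × ℝ)) : Prop :=
  ∃ (γ : ℝ → ℝ × ℝ) (T : ℝ), 0 < T ∧ IsTrajectory X γ ∧ (∀ t, γ (t + T) = γ t) ∧
    (∃ t, γ t ≠ γ 0) ∧ Γ = range γ

/-- The crossing sets of the two switching lines `x = -1` and `x = 1`: the first components of the
two adjacent fields are nonzero and have the same sign. -/
def crossingSet (X : Zone → ℝ × ℝ → ℝ × ℝ) : Set (ℝ × ℝ) :=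
  {z | (z.1 = -1 ∧ 0 < (X .L z).1 * (X .C z).1) ∨ (z.1 = 1 ∧ 0 < (X .R z).1 * (X .C z).1)}

/-- A crossing periodic orbit: it meets the switching lines only at crossing points. -/
def IsCrossingPeriodicOrbit (X : Zone → ℝ × ℝ → ℝ × ℝ) (Γ : Set (ℝ × ℝ)) : Prop :=
  IsPeriodicOrbit X Γ ∧ ∀ z ∈ Γ, z.1 = -1 ∨ z.1 = 1 → z ∈ crossingSet X

/-- A (crossing) limit cycle: a crossing periodic orbit that is isolated among all periodic orbits.
Since such an orbit is compact and the crossing sets are relatively open in the switching lines,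
small neighbourhoods of it contain no sliding motion, so only concatenated trajectories matter. -/
def IsLimitCycle (X : Zone → ℝ × ℝ → ℝ × ℝ) (Γ : Set (ℝ × ℝ)) : Prop :=
  IsCrossingPeriodicOrbit X Γ ∧
    ∃ U : Set (ℝ × ℝ), IsOpen U ∧ Γ ⊆ U ∧ ∀ Γ', IsPeriodicOrbit X Γ' → Γ' ⊆ U → Γ' = Γ

/-- The set has points in each of the three open zones. -/
def VisitsAllZones (Γ : Set (ℝ × ℝ)) : Prop :=
  ∀ Z : Zone, (Γ ∩ Z.openRegion).Nonempty

/-- The Hamiltonian with `a_L = b_L = b_R = c_R = 1`, `a_R = c_L = 0`, `β_L = 2`, `β_R = -2`. -/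
def scsHam : Zone → QuadHam :=
  normalForm (aL := 1) (bL := 1) (cL := 0) (βL := 2) (aR := 0) (bR := 1) (cR := 1) (βR := -2)

end PiecewiseHam

/-!
The perturbation consists of isotropic dilations about the equilibria of the three subsystems and
of a constant horizontal field in the right zone, which only moves the right saddle
(`pertField_eq`). Such a perturbation multiplies the linear flow of a zone by a scalar exponential,
so that every arc is explicit: an orbit passes from one point of a switching line to the next one
exactly if a relation between the two heights holds, the comparison of the values of a first
integral (`relR`, `relC`, `relL`). Four such passages form a chain (`IsChain`), whose heights are,
by the implicit function theorem, analytic functions of `ε` and of the initial height `h`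
(`exists_chain`). The last of them is the return map to the line `x = 1`. It is the identity for
`ε = 0`, and its derivative in `ε` at `ε = 0` is `melnikov p r b c h / h` (`hasDerivAt_return`).

The Melnikov functions `melnikov p r b c` are exactly the linear combinations of four functions
which are, as `h → 0`, of the orders `1`, `h`, `h ^ 3` and `o(h ^ 3)`. Taking coefficients of
alternating signs and rapidly decreasing size yields four points in `(0, 1)` at which the signs
alternate (`exists_melnikov_alternating`), hence three sign changes.

Near a sign change and for small `ε > 0` the displacement `h ↦ k₅ (ε, h) - h` takes both signs, and
being analytic it has an isolated zero (`exists_isolated_zero`). This zero gives a limit cycle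
(`IsReturnMap.isLimitCycle`). For the isolation among *all* periodic orbits in a neighbourhood, the
neighbourhood is made of regular points (`regularSet`), at which the switching lines are crossed and
the fields wind around: a periodic trajectory through such points reaches its maximum of `x` in the
open right zone, and leaves that zone, so it enters it through the section
(`IsTrajectory.exists_mem_upSection`). Uniqueness of solutions across crossing points
(`IsPath.eqOn_of_crossing`) then identifies its successive hits with the iterates of the return
map, which is increasing, so that all hits are fixed points. Neither a stability argument nor the
simplicity of the zeros of the Melnikov function is needed.
-/

namespace PiecewiseHam

open Filter Topology Asymptotics
open scoped ContDiff

section trajectories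

variable {X : Zone → ℝ × ℝ → ℝ × ℝ}

/-! ### Arcs, paths and their concatenation -/

lemma IsArc.mono {Z : Zone} {γ : ℝ → ℝ × ℝ} {s t s' t' : ℝ} (h : IsArc X Z γ s t)
    (hs : s ≤ s') (ht : t' ≤ t) : IsArc X Z γ s' t' := fun τ hτ =>
  have hsub : Icc s' t' ⊆ Icc s t := Icc_subset_Icc hs ht
  ⟨(h τ (hsub hτ)).1, (h τ (hsub hτ)).2.mono hsub⟩

lemma IsArc.congr {Z : Zone} {γ γ' : ℝ → ℝ × ℝ} {s t : ℝ} (h : IsArc X Z γ s t)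
    (he : EqOn γ' γ (Icc s t)) : IsArc X Z γ' s t := fun τ hτ => by
  have h1 := h τ hτ
  rw [he hτ]
  exact ⟨h1.1, h1.2.congr he (he hτ)⟩

lemma IsArc.shift {Z : Zone} {γ : ℝ → ℝ × ℝ} {s t : ℝ} (h : IsArc X Z γ s t) (c : ℝ) :
    IsArc X Z (fun τ => γ (τ - c)) (s + c) (t + c) := fun τ hτ => by
  have hτ' : τ - c ∈ Icc s t := ⟨by linarith [hτ.1], by linarith [hτ.2]⟩
  refine ⟨(h _ hτ').1, ?_⟩
  have h1 : HasDerivWithinAt (fun x : ℝ => x - c) 1 (Icc (s + c) (t + c)) τ :=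
    (hasDerivWithinAt_id _ _).sub_const c
  have hmaps : MapsTo (fun x : ℝ => x - c) (Icc (s + c) (t + c)) (Icc s t) :=
    fun x hx => ⟨by linarith [hx.1], by linarith [hx.2]⟩
  have h2 := HasDerivWithinAt.scomp τ (h _ hτ').2 h1 hmaps
  rw [one_smul] at h2
  exact h2

/-- A solution of the piecewise system on `[s, t]`: next to each time of the interval, on both
sides as far as they lie in the interval, the curve follows one of the subsystems in its zone. -/
def IsPath (X : Zone → ℝ × ℝ → ℝ × ℝ) (γ : ℝ → ℝ × ℝ) (s t : ℝ) : Prop :=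
  (∀ τ ∈ Ico s t, ∃ δ > 0, τ + δ ≤ t ∧ ∃ Z, IsArc X Z γ τ (τ + δ)) ∧
    ∀ τ ∈ Ioc s t, ∃ δ > 0, s ≤ τ - δ ∧ ∃ Z, IsArc X Z γ (τ - δ) τ

lemma IsArc.isPath {Z : Zone} {γ : ℝ → ℝ × ℝ} {s t : ℝ} (h : IsArc X Z γ s t) :
    IsPath X γ s t := by
  refine ⟨fun τ hτ => ⟨t - τ, by linarith [hτ.2], by linarith, Z, h.mono hτ.1 (by linarith)⟩,
    fun τ hτ => ⟨τ - s, by linarith [hτ.1], by linarith, Z, h.mono (by linarith) hτ.2⟩⟩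

lemma IsPath.congr {γ γ' : ℝ → ℝ × ℝ} {s t : ℝ} (h : IsPath X γ s t)
    (he : EqOn γ' γ (Icc s t)) : IsPath X γ' s t := by
  refine ⟨fun τ hτ => ?_, fun τ hτ => ?_⟩
  · obtain ⟨δ, hδ, hle, Z, hZ⟩ := h.1 τ hτ
    exact ⟨δ, hδ, hle, Z, hZ.congr (he.mono (Icc_subset_Icc hτ.1 hle))⟩
  · obtain ⟨δ, hδ, hle, Z, hZ⟩ := h.2 τ hτ
    exact ⟨δ, hδ, hle, Z, hZ.congr (he.mono (Icc_subset_Icc hle hτ.2))⟩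

lemma IsPath.shift {γ : ℝ → ℝ × ℝ} {s t : ℝ} (h : IsPath X γ s t) (c : ℝ) :
    IsPath X (fun τ => γ (τ - c)) (s + c) (t + c) := by
  refine ⟨fun τ hτ => ?_, fun τ hτ => ?_⟩
  · obtain ⟨δ, hδ, hle, Z, hZ⟩ := h.1 (τ - c) ⟨by linarith [hτ.1], by linarith [hτ.2]⟩
    refine ⟨δ, hδ, by linarith, Z, ?_⟩
    convert hZ.shift c using 1 <;> ring
  · obtain ⟨δ, hδ, hle, Z, hZ⟩ := h.2 (τ - c) ⟨by linarith [hτ.1], by linarith [hτ.2]⟩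
    refine ⟨δ, hδ, by linarith, Z, ?_⟩
    convert hZ.shift c using 1 <;> ring

lemma IsPath.trans {γ : ℝ → ℝ × ℝ} {s u t : ℝ} (h₁ : IsPath X γ s u) (h₂ : IsPath X γ u t)
    (hsu : s ≤ u) (hut : u ≤ t) : IsPath X γ s t := by
  refine ⟨fun τ hτ => ?_, fun τ hτ => ?_⟩
  · rcases lt_or_ge τ u with h | h
    · obtain ⟨δ, hδ, hle, hZ⟩ := h₁.1 τ ⟨hτ.1, h⟩
      exact ⟨δ, hδ, by linarith, hZ⟩
    · exact h₂.1 τ ⟨h, hτ.2⟩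
  · rcases le_or_gt τ u with h | h
    · exact h₁.2 τ ⟨hτ.1, h⟩
    · obtain ⟨δ, hδ, hle, hZ⟩ := h₂.2 τ ⟨h, hτ.2⟩
      exact ⟨δ, hδ, by linarith, hZ⟩

/-- The curve that follows `γ₁` during the time `T` and then `γ₂`, started at its time `0`. -/
noncomputable def concat (γ₁ : ℝ → ℝ × ℝ) (T : ℝ) (γ₂ : ℝ → ℝ × ℝ) : ℝ → ℝ × ℝ :=
  fun t => if t ≤ T then γ₁ t else γ₂ (t - T)

lemma concat_of_le {γ₁ γ₂ : ℝ → ℝ × ℝ} {T t : ℝ} (h : t ≤ T) : concat γ₁ T γ₂ t = γ₁ t :=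
  if_pos h

lemma concat_of_ge {γ₁ γ₂ : ℝ → ℝ × ℝ} {T t : ℝ} (h : T ≤ t) (hm : γ₁ T = γ₂ 0) :
    concat γ₁ T γ₂ t = γ₂ (t - T) := by
  rcases h.eq_or_lt with rfl | h
  · simp [concat, hm]
  · exact if_neg (not_le.2 h)

lemma IsPath.concat {γ₁ γ₂ : ℝ → ℝ × ℝ} {T₁ T₂ : ℝ} (h₁ : IsPath X γ₁ 0 T₁)
    (h₂ : IsPath X γ₂ 0 T₂) (hT₁ : 0 ≤ T₁) (hT₂ : 0 ≤ T₂) (hm : γ₁ T₁ = γ₂ 0) :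
    IsPath X (concat γ₁ T₁ γ₂) 0 (T₁ + T₂) := by
  refine IsPath.trans (u := T₁) (h₁.congr fun t ht => concat_of_le ht.2) ?_ hT₁ (by linarith)
  have h := h₂.shift T₁
  rw [zero_add, add_comm] at h
  exact h.congr fun t ht => concat_of_ge ht.1 hm

/-- The `T`-periodic curve that agrees with `γ` on `[0, T)`. -/
noncomputable def periodize (γ : ℝ → ℝ × ℝ) (T : ℝ) : ℝ → ℝ × ℝ :=
  fun t => γ (t - ⌊t / T⌋ * T)

lemma periodize_add (γ : ℝ → ℝ × ℝ) {T : ℝ} (hT : 0 < T) (t : ℝ) :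
    periodize γ T (t + T) = periodize γ T t := by
  have : (t + T) / T = t / T + 1 := by field_simp
  simp only [periodize, this, Int.floor_add_one]
  congr 1; push_cast; ring

lemma periodize_eq {γ : ℝ → ℝ × ℝ} {T : ℝ} (hT : 0 < T) (hγ : γ T = γ 0) (n : ℤ) :
    EqOn (periodize γ T) (fun t => γ (t - n * T)) (Icc (n * T) (n * T + T)) := by
  intro t ht
  rcases ht.2.eq_or_lt with h | h
  · have : ⌊t / T⌋ = n + 1 := by
      rw [h, Int.floor_eq_iff]
      have : (n * T + T) / T = n + 1 := by field_simp
      rw [this]; push_cast; constructor <;> linarith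
    simp only [periodize, this]
    rw [h]
    push_cast
    rw [show (n : ℝ) * T + T - (n + 1) * T = 0 by ring,
      show (n : ℝ) * T + T - n * T = T by ring, hγ]
  · have : ⌊t / T⌋ = n := by
      rw [Int.floor_eq_iff, le_div_iff₀ hT, div_lt_iff₀ hT]
      exact ⟨ht.1, by linarith⟩
    simp only [periodize, this]

lemma periodize_eqOn {γ : ℝ → ℝ × ℝ} {T : ℝ} (hT : 0 < T) (hγ : γ T = γ 0) :
    EqOn (periodize γ T) γ (Icc 0 T) := by
  have := periodize_eq hT hγ 0
  simpa using this

lemma range_periodize {γ : ℝ → ℝ × ℝ} {T : ℝ} (hT : 0 < T) (hγ : γ T = γ 0) :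
    range (periodize γ T) = γ '' Icc 0 T := by
  ext z
  constructor
  · rintro ⟨t, rfl⟩
    refine ⟨t - ⌊t / T⌋ * T, ⟨?_, ?_⟩, rfl⟩
    · have := (le_div_iff₀ hT).1 (Int.floor_le (t / T)); linarith
    · have := (div_lt_iff₀ hT).1 (Int.lt_floor_add_one (t / T)); linarith
  · rintro ⟨t, ht, rfl⟩
    exact ⟨t, periodize_eqOn hT hγ ht⟩

/-- The periodic extension of a closed path is a trajectory. -/
lemma IsPath.isTrajectory_periodize {γ : ℝ → ℝ × ℝ} {T : ℝ} (h : IsPath X γ 0 T) (hT : 0 < T)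
    (hγ : γ T = γ 0) : IsTrajectory X (periodize γ T) := by
  have key : ∀ n : ℤ, IsPath X (periodize γ T) (n * T) (n * T + T) := fun n => by
    have h1 := h.shift (n * T)
    rw [zero_add, add_comm T] at h1
    exact h1.congr (periodize_eq hT hγ n)
  intro t
  constructor
  · obtain ⟨δ, hδ, -, Z, hZ⟩ := (key ⌊t / T⌋).1 t
      ⟨(le_div_iff₀ hT).1 (Int.floor_le (t / T)), by
        have := (div_lt_iff₀ hT).1 (Int.lt_floor_add_one (t / T)); linarith⟩
    exact ⟨δ, hδ, Z, hZ⟩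
  · obtain ⟨δ, hδ, -, Z, hZ⟩ := (key (⌈t / T⌉ - 1)).2 t
      ⟨by
        have := (lt_div_iff₀ hT).1 (sub_lt_iff_lt_add.2 (Int.ceil_lt_add_one (t / T)))
        push_cast; linarith, by
        have := (div_le_iff₀ hT).1 (Int.le_ceil (t / T)); push_cast; linarith⟩
    exact ⟨δ, hδ, Z, hZ⟩

lemma IsTrajectory.shift {γ : ℝ → ℝ × ℝ} (h : IsTrajectory X γ) (c : ℝ) :
    IsTrajectory X (fun t => γ (c + t)) := by
  intro t
  obtain ⟨⟨δ, hδ, Z, hZ⟩, ⟨δ', hδ', Z', hZ'⟩⟩ := h (c + t)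
  refine ⟨⟨δ, hδ, Z, ?_⟩, ⟨δ', hδ', Z', ?_⟩⟩
  · have := hZ.shift (-c)
    simp only [sub_neg_eq_add, add_comm _ c] at this
    convert this using 1 <;> ring
  · have := hZ'.shift (-c)
    simp only [sub_neg_eq_add, add_comm _ c] at this
    convert this using 1 <;> ring

lemma IsTrajectory.isPath {γ : ℝ → ℝ × ℝ} (h : IsTrajectory X γ) (s t : ℝ) : IsPath X γ s t := by
  refine ⟨fun τ hτ => ?_, fun τ hτ => ?_⟩
  · obtain ⟨δ, hδ, Z, hZ⟩ := (h τ).1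
    exact ⟨min δ (t - τ), lt_min hδ (by linarith [hτ.2]), by linarith [min_le_right δ (t - τ)], Z,
      hZ.mono le_rfl (by linarith [min_le_left δ (t - τ)])⟩
  · obtain ⟨δ, hδ, Z, hZ⟩ := (h τ).2
    exact ⟨min δ (τ - s), lt_min hδ (by linarith [hτ.1]), by linarith [min_le_right δ (τ - s)], Z,
      hZ.mono (by linarith [min_le_left δ (τ - s)]) le_rfl⟩

lemma IsArc.continuousOn {Z : Zone} {γ : ℝ → ℝ × ℝ} {s t : ℝ} (h : IsArc X Z γ s t) :
    ContinuousOn γ (Icc s t) := fun τ hτ => (h τ hτ).2.continuousWithinAt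

lemma IsPath.continuousOn {γ : ℝ → ℝ × ℝ} {s t : ℝ} (h : IsPath X γ s t) :
    ContinuousOn γ (Icc s t) := by
  intro τ hτ
  have hr : ContinuousWithinAt γ (Icc τ t) τ := by
    rcases hτ.2.eq_or_lt with rfl | hlt
    · simp
    · obtain ⟨δ, hδ, hle, Z, hZ⟩ := h.1 τ ⟨hτ.1, hlt⟩
      exact (hZ.continuousOn τ ⟨le_rfl, by linarith⟩).mono_of_mem_nhdsWithin
        (nhdsWithin_mono τ Icc_subset_Ici_self (Icc_mem_nhdsGE (by linarith : τ < τ + δ)))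
  have hl : ContinuousWithinAt γ (Icc s τ) τ := by
    rcases hτ.1.eq_or_lt with rfl | hlt
    · simp
    · obtain ⟨δ, hδ, hle, Z, hZ⟩ := h.2 τ ⟨hlt, hτ.2⟩
      exact (hZ.continuousOn τ ⟨by linarith, le_rfl⟩).mono_of_mem_nhdsWithin
        (nhdsWithin_mono τ Icc_subset_Iic_self (Icc_mem_nhdsLE (by linarith : τ - δ < τ)))
  have := hl.union hr
  rwa [Icc_union_Icc_eq_Icc hτ.1 hτ.2] at this

lemma IsTrajectory.continuous {γ : ℝ → ℝ × ℝ} (h : IsTrajectory X γ) : Continuous γ := by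
  rw [continuous_iff_continuousAt]
  intro t
  exact ((h.isPath (t - 1) (t + 1)).continuousOn).continuousAt
    (Icc_mem_nhds (by linarith) (by linarith))

/-! ### One-sided derivatives and uniqueness across the switching lines -/

lemma nonneg_of_hasDerivWithinAt_of_ge {f : ℝ → ℝ} {d t δ : ℝ} (hδ : 0 < δ)
    (hf : HasDerivWithinAt f d (Icc t (t + δ)) t) (hge : ∀ τ ∈ Icc t (t + δ), f t ≤ f τ) :
    0 ≤ d := by
  have h1 : HasDerivWithinAt f d (Ioc t (t + δ)) t := hf.mono Ioc_subset_Icc_self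
  rw [hasDerivWithinAt_iff_tendsto_slope' (by simp)] at h1
  have : (𝓝[Ioc t (t + δ)] t).NeBot := by
    rw [nhdsWithin_Ioc_eq_nhdsGT (by linarith)]; infer_instance
  refine ge_of_tendsto h1 (eventually_nhdsWithin_of_forall fun τ hτ => ?_)
  rw [slope_def_field]
  exact div_nonneg (by linarith [hge τ (Ioc_subset_Icc_self hτ)]) (by linarith [hτ.1])

lemma nonpos_of_hasDerivWithinAt_of_le {f : ℝ → ℝ} {d t δ : ℝ} (hδ : 0 < δ)
    (hf : HasDerivWithinAt f d (Icc t (t + δ)) t) (hge : ∀ τ ∈ Icc t (t + δ), f τ ≤ f t) :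
    d ≤ 0 := by
  have := nonneg_of_hasDerivWithinAt_of_ge hδ hf.neg (fun τ hτ => neg_le_neg (hge τ hτ))
  linarith

lemma nonneg_of_hasDerivWithinAt_left_of_le {f : ℝ → ℝ} {d t δ : ℝ} (hδ : 0 < δ)
    (hf : HasDerivWithinAt f d (Icc (t - δ) t) t) (hge : ∀ τ ∈ Icc (t - δ) t, f τ ≤ f t) :
    0 ≤ d := by
  have h1 : HasDerivWithinAt (fun x : ℝ => -x) (-1) (Icc (-t) (-t + δ)) (-t) :=
    (hasDerivWithinAt_id _ _).neg
  have hmaps : MapsTo (fun x : ℝ => -x) (Icc (-t) (-t + δ)) (Icc (t - δ) t) :=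
    fun x hx => ⟨by linarith [hx.2], by linarith [hx.1]⟩
  rw [← neg_neg t] at hf
  have h2 := HasDerivWithinAt.scomp (-t) (by simpa using hf) h1 (by simpa using hmaps)
  have := nonpos_of_hasDerivWithinAt_of_le hδ h2
    (fun τ hτ => by simpa using hge _ (hmaps hτ))
  simpa using this

lemma IsArc.fst {Z : Zone} {γ : ℝ → ℝ × ℝ} {s t τ : ℝ} (h : IsArc X Z γ s t) (hτ : τ ∈ Icc s t) :
    HasDerivWithinAt (fun u => (γ u).1) (X Z (γ τ)).1 (Icc s t) τ :=
  (hasFDerivAt_fst (𝕜 := ℝ) (p := γ τ)).comp_hasDerivWithinAt τ (h τ hτ).2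

lemma IsArc.snd {Z : Zone} {γ : ℝ → ℝ × ℝ} {s t τ : ℝ} (h : IsArc X Z γ s t) (hτ : τ ∈ Icc s t) :
    HasDerivWithinAt (fun u => (γ u).2) (X Z (γ τ)).2 (Icc s t) τ :=
  (hasFDerivAt_snd (𝕜 := ℝ) (p := γ τ)).comp_hasDerivWithinAt τ (h τ hτ).2

/-- Two curves leaving a common point, which is a crossing point if it lies on a switching line,
enter the same zone. -/
lemma IsArc.zone_eq {Z₁ Z₂ : Zone} {γ₁ γ₂ : ℝ → ℝ × ℝ} {t δ₁ δ₂ : ℝ}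
    (h₁ : IsArc X Z₁ γ₁ t (t + δ₁)) (h₂ : IsArc X Z₂ γ₂ t (t + δ₂)) (hδ₁ : 0 < δ₁) (hδ₂ : 0 < δ₂)
    (he : γ₁ t = γ₂ t)
    (hc : (γ₁ t).1 = -1 ∨ (γ₁ t).1 = 1 → γ₁ t ∈ crossingSet X) : Z₁ = Z₂ := by
  have m₁ : t ∈ Icc t (t + δ₁) := ⟨le_rfl, by linarith⟩
  have m₂ : t ∈ Icc t (t + δ₂) := ⟨le_rfl, by linarith⟩
  have r₁ := (h₁ t m₁).1
  have r₂ := (h₂ t m₂).1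
  have d₁ := h₁.fst m₁
  have d₂ := h₂.fst m₂
  rw [← he] at r₂ d₂
  have c₁ := fun τ hτ => (h₁ τ hτ).1
  have c₂ := fun τ hτ => (h₂ τ hτ).1
  have e1 : (γ₂ t).1 = (γ₁ t).1 := by rw [he]
  have up₁ : (∀ τ ∈ Icc t (t + δ₁), (γ₁ t).1 ≤ (γ₁ τ).1) → 0 ≤ (X Z₁ (γ₁ t)).1 := fun h =>
    nonneg_of_hasDerivWithinAt_of_ge hδ₁ d₁ h
  have dn₁ : (∀ τ ∈ Icc t (t + δ₁), (γ₁ τ).1 ≤ (γ₁ t).1) → (X Z₁ (γ₁ t)).1 ≤ 0 := fun h =>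
    nonpos_of_hasDerivWithinAt_of_le hδ₁ d₁ h
  have up₂ : (∀ τ ∈ Icc t (t + δ₂), (γ₁ t).1 ≤ (γ₂ τ).1) → 0 ≤ (X Z₂ (γ₁ t)).1 := fun h =>
    nonneg_of_hasDerivWithinAt_of_ge hδ₂ d₂ (by simpa only [e1] using h)
  have dn₂ : (∀ τ ∈ Icc t (t + δ₂), (γ₂ τ).1 ≤ (γ₁ t).1) → (X Z₂ (γ₁ t)).1 ≤ 0 := fun h =>
    nonpos_of_hasDerivWithinAt_of_le hδ₂ d₂ (by simpa only [e1] using h)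
  cases Z₁ <;> cases Z₂ <;>
    simp only [Zone.closedRegion, mem_ofPred_eq, crossingSet] at * <;> try rfl
  · have hx : (γ₁ t).1 = -1 := le_antisymm r₁ r₂.1
    have a := dn₁ fun τ hτ => by rw [hx]; exact c₁ τ hτ
    have b := up₂ fun τ hτ => by rw [hx]; exact (c₂ τ hτ).1
    rcases hc (Or.inl hx) with h | h
    · nlinarith [h.2]
    · linarith [h.1]
  · linarith
  · have hx : (γ₁ t).1 = -1 := le_antisymm r₂ r₁.1
    have a := dn₂ fun τ hτ => by rw [hx]; exact c₂ τ hτ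
    have b := up₁ fun τ hτ => by rw [hx]; exact (c₁ τ hτ).1
    rcases hc (Or.inl hx) with h | h
    · nlinarith [h.2]
    · linarith [h.1]
  · have hx : (γ₁ t).1 = 1 := le_antisymm r₁.2 r₂
    have a := dn₁ fun τ hτ => by rw [hx]; exact (c₁ τ hτ).2
    have b := up₂ fun τ hτ => by rw [hx]; exact c₂ τ hτ
    rcases hc (Or.inr hx) with h | h
    · linarith [h.1]
    · nlinarith [h.2]
  · linarith
  · have hx : (γ₁ t).1 = 1 := le_antisymm r₂.2 r₁
    have a := dn₂ fun τ hτ => by rw [hx]; exact (c₂ τ hτ).2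
    have b := up₁ fun τ hτ => by rw [hx]; exact c₁ τ hτ
    rcases hc (Or.inr hx) with h | h
    · linarith [h.1]
    · nlinarith [h.2]

/-- Forward uniqueness: a path that meets the switching lines only at crossing points is
determined by its initial point. -/
theorem IsPath.eqOn_of_crossing (hX : ∀ Z, ∃ K, LipschitzWith K (X Z)) {γ γ' : ℝ → ℝ × ℝ}
    {s t : ℝ} (h : IsPath X γ s t) (h' : IsPath X γ' s t) (he : γ s = γ' s)
    (hc : ∀ τ ∈ Icc s t, (γ τ).1 = -1 ∨ (γ τ).1 = 1 → γ τ ∈ crossingSet X) :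
    EqOn γ γ' (Icc s t) := by
  have hcl : IsClosed ({τ | γ τ = γ' τ} ∩ Icc s t) := by
    have := isClosed_Icc.isClosed_eq h.continuousOn h'.continuousOn
    rwa [inter_comm]
  refine hcl.Icc_subset_of_forall_exists_gt he ?_
  rintro τ ⟨hτe, hτ⟩ y hy
  obtain ⟨δ₁, hδ₁, hle₁, Z₁, hZ₁⟩ := h.1 τ hτ
  obtain ⟨δ₂, hδ₂, hle₂, Z₂, hZ₂⟩ := h'.1 τ hτ
  obtain rfl := hZ₁.zone_eq hZ₂ hδ₁ hδ₂ hτe (hc τ (Ico_subset_Icc_self hτ))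
  have hy' : τ < y := hy
  set δ := min (min δ₁ δ₂) (y - τ) with hδ
  have hδ0 : 0 < δ := lt_min (lt_min hδ₁ hδ₂) (by linarith)
  have l1 : δ ≤ δ₁ := (min_le_left _ _).trans (min_le_left _ _)
  have l2 : δ ≤ δ₂ := (min_le_left _ _).trans (min_le_right _ _)
  have l3 : δ ≤ y - τ := min_le_right _ _
  have a₁ := hZ₁.mono le_rfl (by linarith : τ + δ ≤ τ + δ₁)
  have a₂ := hZ₂.mono le_rfl (by linarith : τ + δ ≤ τ + δ₂)
  obtain ⟨K, hK⟩ := hX Z₁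
  have ha : ∀ {g : ℝ → ℝ × ℝ}, IsArc X Z₁ g τ (τ + δ) → ∀ u ∈ Ico τ (τ + δ),
      HasDerivWithinAt g (X Z₁ (g u)) (Ici u) u := fun {g} hg u hu =>
    (hg u (Ico_subset_Icc_self hu)).2.mono_of_mem_nhdsWithin
      (mem_of_superset (Icc_mem_nhdsGE hu.2) (Icc_subset_Icc_left hu.1))
  have := ODE_solution_unique (v := fun _ => X Z₁) (fun _ => hK) a₁.continuousOn (ha a₁)
    a₂.continuousOn (ha a₂) hτe
  exact ⟨τ + δ, this ⟨by linarith, le_rfl⟩, by linarith, by linarith⟩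

/-! ### Regular points and isolated closed paths -/

/-- Points near which orbits wind around: in the central zone the motion is not vertical, the
switching lines are crossed, and the outer zones are traversed downwards on the right and upwards
on the left. -/
def regularSet (X : Zone → ℝ × ℝ → ℝ × ℝ) : Set (ℝ × ℝ) :=
  {z | (z.1 ∈ Icc (-1) 1 → (X .C z).1 ≠ 0) ∧ (z.1 = -1 → 0 < (X .L z).1 * (X .C z).1) ∧
    (z.1 = 1 → 0 < (X .R z).1 * (X .C z).1) ∧ (1 ≤ z.1 → (X .R z).2 < 0) ∧
    (z.1 ≤ -1 → 0 < (X .L z).2)}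

/-- The part of the line `x = 1` where the central field points to the right; the return map is
taken with respect to it. -/
def upSection (X : Zone → ℝ × ℝ → ℝ × ℝ) : Set (ℝ × ℝ) :=
  {z | z.1 = 1 ∧ 0 < (X .C z).1}

lemma mem_crossingSet_of_regular {z : ℝ × ℝ} (h : z ∈ regularSet X) (hz : z.1 = -1 ∨ z.1 = 1) :
    z ∈ crossingSet X :=
  hz.imp (fun h1 => ⟨h1, h.2.1 h1⟩) fun h1 => ⟨h1, h.2.2.1 h1⟩

lemma isOpen_setOf_imp {p q : ℝ × ℝ → Prop} (hp : IsClosed {z | p z}) (hq : IsOpen {z | q z}) :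
    IsOpen {z | p z → q z} := by
  have : {z | p z → q z} = {z | p z}ᶜ ∪ {z | q z} := by
    ext z; simp [imp_iff_not_or]
  rw [this]
  exact hp.isOpen_compl.union hq

lemma isOpen_regularSet (hX : ∀ Z, Continuous (X Z)) : IsOpen (regularSet X) := by
  have c1 : ∀ Z, Continuous fun z => (X Z z).1 := fun Z => continuous_fst.comp (hX Z)
  have c2 : ∀ Z, Continuous fun z => (X Z z).2 := fun Z => continuous_snd.comp (hX Z)
  have e : ∀ a : ℝ, IsClosed {z : ℝ × ℝ | z.1 = a} := fun a =>
    isClosed_eq continuous_fst continuous_const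
  refine (isOpen_setOf_imp (isClosed_Icc.preimage continuous_fst)
    (isOpen_ne_fun (c1 _) continuous_const)).inter
    ((isOpen_setOf_imp (e _) (isOpen_lt continuous_const ((c1 _).mul (c1 _)))).inter
    ((isOpen_setOf_imp (e _) (isOpen_lt continuous_const ((c1 _).mul (c1 _)))).inter
    ((isOpen_setOf_imp (isClosed_le continuous_const continuous_fst)
      (isOpen_lt (c2 _) continuous_const)).inter
    (isOpen_setOf_imp (isClosed_le continuous_fst continuous_const)
      (isOpen_lt continuous_const (c2 _))))))

lemma exists_forall_le_of_periodic {f : ℝ → ℝ} {T : ℝ} (hf : Continuous f) (hT : 0 < T)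
    (hp : ∀ t, f (t + T) = f t) : ∃ t, ∀ u, f u ≤ f t := by
  have hc := Function.Periodic.compact_of_continuous (f := f) hp hT.ne' hf
  obtain ⟨_, ⟨t, rfl⟩, ht⟩ := hc.exists_isGreatest (range_nonempty f)
  exact ⟨t, fun u => ht (mem_range_self u)⟩

/-- At a regular point of the closed central strip, the fields of the zones containing the point
point to the same side. -/
lemma not_nonpos_and_nonneg_of_regular {z : ℝ × ℝ} (h : z ∈ regularSet X)
    (hz : z.1 ∈ Icc (-1 : ℝ) 1) {Z Z' : Zone} (hZ : z ∈ Z.closedRegion) (hZ' : z ∈ Z'.closedRegion)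
    (h1 : (X Z z).1 ≤ 0) (h2 : 0 ≤ (X Z' z).1) : False := by
  have key : ∀ W : Zone, z ∈ W.closedRegion → 0 < (X W z).1 * (X .C z).1 := by
    intro W hW
    cases W
    · exact h.2.1 (le_antisymm hW hz.1)
    · have := h.1 hz
      exact mul_self_pos.2 this
    · exact h.2.2.1 (le_antisymm hz.2 hW)
  have a := key Z hZ
  have b := key Z' hZ'
  rcases lt_or_ge (X .C z).1 0 with h0 | h0 <;> nlinarith

/-- A periodic trajectory through regular points meets the section: the maximum of `x` exceeds
`1`, and the orbit is not contained in the closed right zone. -/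
theorem IsTrajectory.exists_mem_upSection {γ : ℝ → ℝ × ℝ} (h : IsTrajectory X γ) {T : ℝ}
    (hT : 0 < T) (hp : ∀ t, γ (t + T) = γ t) (hreg : ∀ t, γ t ∈ regularSet X) :
    ∃ t, γ t ∈ upSection X := by
  have hcont := h.continuous
  have hc1 : Continuous fun t => (γ t).1 := continuous_fst.comp hcont
  have hc2 : Continuous fun t => (γ t).2 := continuous_snd.comp hcont
  obtain ⟨tm, htm⟩ := exists_forall_le_of_periodic hc1 hT fun t => by simp only [hp]
  have hgt : 1 < (γ tm).1 := by
    by_contra! hle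
    rcases le_or_gt (-1) (γ tm).1 with hge | hlt
    · obtain ⟨⟨δ, hδ, Z, hZ⟩, ⟨δ', hδ', Z', hZ'⟩⟩ := h tm
      have m : tm ∈ Icc tm (tm + δ) := ⟨le_rfl, by linarith⟩
      have m' : tm ∈ Icc (tm - δ') tm := ⟨by linarith, le_rfl⟩
      exact not_nonpos_and_nonneg_of_regular (hreg tm) ⟨hge, hle⟩ (hZ tm m).1 (hZ' tm m').1
        (nonpos_of_hasDerivWithinAt_of_le hδ (hZ.fst m) fun τ _ => htm τ)
        (nonneg_of_hasDerivWithinAt_left_of_le hδ' (hZ'.fst m') fun τ _ => htm τ)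
    · -- the orbit stays in the left zone, where `y` increases
      obtain ⟨s, hs⟩ := exists_forall_le_of_periodic hc2 hT fun t => by simp only [hp]
      obtain ⟨δ, hδ, Z, hZ⟩ := (h s).1
      have m : s ∈ Icc s (s + δ) := ⟨le_rfl, by linarith⟩
      have hx : (γ s).1 < -1 := (htm s).trans_lt hlt
      have hL := (hreg s).2.2.2.2 hx.le
      have hr := (hZ s m).1
      cases Z
      · exact absurd (nonpos_of_hasDerivWithinAt_of_le hδ (hZ.snd m) fun τ _ => hs τ) (not_le.2 hL)
      · exact absurd hr.1 (not_le.2 hx)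
      · have : 1 ≤ (γ s).1 := hr
        linarith
  have hex : ∃ u, (γ u).1 < 1 := by
    by_contra! hall
    -- the orbit stays in the right zone, where `y` decreases
    obtain ⟨s, hs⟩ := exists_forall_le_of_periodic hc2.neg hT fun t => by
      simp only [Pi.neg_apply, hp]
    obtain ⟨δ, hδ, Z, hZ⟩ := (h s).1
    have m : s ∈ Icc s (s + δ) := ⟨le_rfl, by linarith⟩
    have hr := (hZ s m).1
    have hs1 := hall s
    cases Z
    · have : (γ s).1 ≤ -1 := hr
      linarith
    · have hx : (γ s).1 = 1 := le_antisymm hr.2 hs1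
      have hd := hZ.fst m
      have a := nonneg_of_hasDerivWithinAt_of_ge hδ hd fun τ _ => by rw [hx]; exact hall τ
      have b := nonpos_of_hasDerivWithinAt_of_le hδ hd fun τ hτ => by rw [hx]; exact (hZ τ hτ).1.2
      exact (hreg s).1 ⟨by linarith, hx.le⟩ (le_antisymm b a)
    · exact absurd (nonneg_of_hasDerivWithinAt_of_ge hδ (hZ.snd m) fun τ _ => by
        simpa using hs τ) (not_le.2 ((hreg s).2.2.2.1 hs1))
  obtain ⟨u, hu⟩ := hex
  -- a time with `x > 1` after `u`
  obtain ⟨n, hn⟩ : ∃ n : ℕ, u ≤ tm + n * T := by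
    obtain ⟨n, hn⟩ := exists_nat_ge ((u - tm) / T)
    exact ⟨n, by rw [div_le_iff₀ hT] at hn; linarith⟩
  have hper : ∀ n : ℕ, γ (tm + n * T) = γ tm := by
    intro n
    induction n with
    | zero => simp
    | succ k ih => rw [← ih, ← hp (tm + k * T)]; congr 1; push_cast; ring
  set v := tm + n * T with hv
  have hv1 : 1 < (γ v).1 := by rw [hper]; exact hgt
  set S := {t | (γ t).1 ≤ 1} ∩ Icc u v with hS
  have hScl : IsClosed S := (isClosed_le hc1 continuous_const).inter isClosed_Icc
  have hScp : IsCompact S := isCompact_Icc.of_isClosed_subset hScl inter_subset_right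
  obtain ⟨t, ⟨ht1, htI⟩, htmax⟩ := hScp.exists_isGreatest ⟨u, hu.le, le_rfl, hn⟩
  have htv : t < v := lt_of_le_of_ne htI.2 fun h' => by
    rw [h'] at ht1; exact absurd ht1 (not_le.2 hv1)
  have hafter : ∀ τ, t < τ → τ ≤ v → 1 < (γ τ).1 := fun τ h1 h2 => by
    by_contra! h3
    exact absurd (htmax ⟨h3, htI.1.trans h1.le, h2⟩) (not_le.2 h1)
  have hge : 1 ≤ (γ t).1 := by
    have : Tendsto (fun τ => (γ τ).1) (𝓝[>] t) (𝓝 (γ t).1) :=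
      hc1.continuousAt.tendsto.mono_left nhdsWithin_le_nhds
    refine ge_of_tendsto this ?_
    filter_upwards [Ioc_mem_nhdsGT htv] with τ hτ using (hafter τ hτ.1 hτ.2).le
  have hx : (γ t).1 = 1 := le_antisymm ht1 hge
  obtain ⟨δ, hδ, Z, hZ⟩ := (h t).1
  have m : t ∈ Icc t (t + δ) := ⟨le_rfl, by linarith⟩
  have hZR : Z = .R := by
    set w := min (t + δ) v with hw
    have hw1 : t < w := lt_min (by linarith) htv
    have h1 := (hZ w ⟨hw1.le, min_le_left _ _⟩).1
    have h2 := hafter w hw1 (min_le_right _ _)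
    cases Z
    · have : (γ w).1 ≤ -1 := h1
      linarith
    · exact absurd h1.2 (not_le.2 h2)
    · rfl
  subst hZR
  have hn0 := nonneg_of_hasDerivWithinAt_of_ge hδ (hZ.fst m) fun τ hτ => by
    rw [hx]; exact (hZ τ hτ).1
  refine ⟨t, hx, ?_⟩
  have hpos := (hreg t).2.2.1 hx
  by_contra! hneg
  nlinarith

/-- Two periodic trajectories with a common point, one of them regular, have the same orbit. -/
lemma range_eq_of_mem_closed_path (hX : ∀ Z, ∃ K, LipschitzWith K (X Z))
    {γ γ' : ℝ → ℝ × ℝ} {T T' t₀ : ℝ} (hT : 0 < T) (hT' : 0 < T') (hγ : IsTrajectory X γ)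
    (hγp : ∀ t, γ (t + T) = γ t) (hγ' : IsTrajectory X γ') (hp' : ∀ t, γ' (t + T') = γ' t)
    (hreg : ∀ t, γ t ∈ regularSet X) (h0 : γ 0 = γ' t₀) : range γ' = range γ := by
  have heq : ∀ t, 0 ≤ t → γ t = γ' (t₀ + t) := fun t ht =>
    (hγ.isPath 0 t).eqOn_of_crossing hX ((hγ'.shift t₀).isPath 0 t) (by simpa using h0)
      (fun τ _ => mem_crossingSet_of_regular (hreg τ)) ⟨ht, le_rfl⟩
  have nat_per : ∀ {g : ℝ → ℝ × ℝ} {P : ℝ}, (∀ t, g (t + P) = g t) → ∀ (n : ℕ) t,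
      g (t + n * P) = g t := by
    intro g P hg n
    induction n with
    | zero => simp
    | succ k ih => intro t; rw [← ih t, ← hg (t + k * P)]; congr 1; push_cast; ring
  have big : ∀ {P : ℝ} (a : ℝ), 0 < P → ∃ n : ℕ, 0 ≤ a + n * P := by
    intro P a hP
    obtain ⟨n, hn⟩ := exists_nat_ge (-a / P)
    exact ⟨n, by rw [div_le_iff₀ hP] at hn; linarith⟩
  apply Subset.antisymm
  · rintro _ ⟨t, rfl⟩
    obtain ⟨n, hn⟩ := big (t - t₀) hT'
    refine ⟨t - t₀ + n * T', ?_⟩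
    rw [heq _ hn, ← nat_per hp' n t]
    congr 1; ring
  · rintro _ ⟨t, rfl⟩
    obtain ⟨n, hn⟩ := big t hT
    exact ⟨t₀ + (t + n * T), by rw [← heq _ hn, nat_per hγp]⟩

/-- A local return map: through each point `(1, h)` with `h ∈ W` there is a regular path that next
meets the section at `(1, P h)`. The travel times are bounded below. -/
structure IsReturnMap (X : Zone → ℝ × ℝ → ℝ × ℝ) (W : Set ℝ) (P : ℝ → ℝ) : Prop where
  exists_path : ∀ h ∈ W, ∃ (T : ℝ) (γ : ℝ → ℝ × ℝ), 1 ≤ T ∧ IsPath X γ 0 T ∧ γ 0 = (1, h) ∧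
    γ T = (1, P h) ∧ (∀ t ∈ Icc 0 T, γ t ∈ regularSet X) ∧ ∀ t ∈ Ioo 0 T, γ t ∉ upSection X
  start_mem : ∀ h ∈ W, ((1 : ℝ), h) ∈ upSection X
  end_mem : ∀ h ∈ W, ((1 : ℝ), P h) ∈ upSection X

/-- A periodic trajectory which meets the section only over `W`, where the return map is increasing,
meets it in fixed points of the return map: otherwise the heights of its successive hits move away
from the first one monotonically and cannot come back. -/
theorem IsReturnMap.fixed_of_periodic {W : Set ℝ} {P : ℝ → ℝ} (hP : IsReturnMap X W P)
    (hX : ∀ Z, ∃ K, LipschitzWith K (X Z)) (hmono : MonotoneOn P W) {γ : ℝ → ℝ × ℝ}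
    (hγ : IsTrajectory X γ) {T : ℝ} (hT : 0 < T) (hp : ∀ t, γ (t + T) = γ t)
    (hW : ∀ t, γ t ∈ upSection X → (γ t).2 ∈ W) {t₀ : ℝ} (ht₀ : γ t₀ ∈ upSection X) :
    P (γ t₀).2 = (γ t₀).2 := by
  set h₀ := (γ t₀).2 with hh₀
  have step : ∀ t h, h ∈ W → γ t = (1, h) → ∃ t', t + 1 ≤ t' ∧ γ t' = (1, P h) ∧
      P h ∈ W ∧ ∀ u ∈ Ioo t t', γ u ∉ upSection X := by
    intro t h hh hth
    obtain ⟨τ, g, hτ, hg, hg0, hgτ, hreg, hns⟩ := hP.exists_path h hh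
    have heq := hg.eqOn_of_crossing hX ((hγ.shift t).isPath 0 τ) (by simp [hg0, hth])
      (fun u hu => mem_crossingSet_of_regular (hreg u hu))
    have hend : γ (t + τ) = (1, P h) := by rw [← hgτ]; exact (heq ⟨by linarith, le_rfl⟩).symm
    refine ⟨t + τ, by linarith, hend, ?_, fun u hu => ?_⟩
    · have := hW (t + τ) (by rw [hend]; exact hP.end_mem h hh)
      rwa [hend] at this
    · have : g (u - t) = γ u := by
        have := heq (x := u - t) ⟨by linarith [hu.1], by linarith [hu.2]⟩
        simpa using this
      rw [← this]
      exact hns _ ⟨by linarith [hu.1], by linarith [hu.2]⟩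
  -- the heights of the successive hits are monotone; `r` is `≤` or `≥`
  have key : ∀ r : ℝ → ℝ → Prop, (∀ a b c, r a b → r b c → r a c) → r h₀ h₀ →
      (∀ y ∈ W, r h₀ y → r (P h₀) (P y)) → r h₀ (P h₀) → r (P h₀) h₀ := by
    intro r htrans hrefl hmon h1
    have ind : ∀ n : ℕ, ∃ t y, t₀ + n ≤ t ∧ y ∈ W ∧ γ t = (1, y) ∧ r h₀ y ∧
        ∀ u ∈ Ioc t₀ t, γ u ∈ upSection X → r (P h₀) (γ u).2 := by
      intro n
      induction n with
      | zero =>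
        refine ⟨t₀, h₀, by simp, hW _ ht₀, Prod.ext ht₀.1 rfl, hrefl, fun u hu => ?_⟩
        exact absurd hu.1 (not_lt.2 hu.2)
      | succ k ih =>
        obtain ⟨t, y, hkt, hyW, hty, hry, hu⟩ := ih
        obtain ⟨t', htt', ht', hW', hno⟩ := step t y hyW hty
        refine ⟨t', P y, by push_cast; linarith, hW', ht', htrans _ _ _ h1 (hmon y hyW hry),
          fun u hu1 hus => ?_⟩
        rcases le_or_gt u t with h2 | h2
        · exact hu u ⟨hu1.1, h2⟩ hus
        · rcases hu1.2.eq_or_lt with h3 | h3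
          · rw [h3, ht']
            exact hmon y hyW hry
          · exact absurd hus (hno u ⟨h2, h3⟩)
    obtain ⟨n, hn⟩ := exists_nat_ge T
    obtain ⟨t, y, hkt, -, -, -, hu⟩ := ind n
    have := hu (t₀ + T) ⟨by linarith, by linarith⟩ (by rw [hp]; exact ht₀)
    rwa [hp] at this
  have hW0 := hW _ ht₀
  rcases le_total h₀ (P h₀) with h | h
  · exact le_antisymm (key (· ≤ ·) (fun _ _ _ => le_trans) le_rfl
      (fun y hy => hmono hW0 hy) h) h
  · exact le_antisymm h (key (· ≥ ·) (fun _ _ _ => ge_trans) le_rfl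
      (fun y hy hy' => hmono hy hW0 hy') h)

/-- An isolated fixed point of an increasing local return map lies on a limit cycle: a periodic
orbit nearby consists of regular points, hence meets the section, and it does so in a fixed point
of the return map. -/
theorem IsReturnMap.isLimitCycle {W : Set ℝ} {P : ℝ → ℝ} (hP : IsReturnMap X W P)
    (hX : ∀ Z, ∃ K, LipschitzWith K (X Z)) (hWo : IsOpen W) (hmono : MonotoneOn P W) {h₀ : ℝ}
    (hh₀ : h₀ ∈ W) (hfix : ∀ h ∈ W, P h = h ↔ h = h₀) {γ : ℝ → ℝ × ℝ} {T : ℝ} (hT : 0 < T)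
    (hγ : IsPath X γ 0 T) (hγ0 : γ 0 = (1, h₀)) (hγT : γ T = (1, h₀))
    (hreg : ∀ t ∈ Icc 0 T, γ t ∈ regularSet X) (hns : ∀ t ∈ Ioo 0 T, γ t ∉ upSection X)
    (hnc : ∃ t ∈ Icc 0 T, γ t ≠ γ 0) : IsLimitCycle X (γ '' Icc 0 T) := by
  have hclosed : γ T = γ 0 := by rw [hγ0, hγT]
  have hg := hγ.isTrajectory_periodize hT hclosed
  have hgp := periodize_add γ hT
  have hrange := range_periodize hT hclosed
  have h0 : periodize γ T 0 = γ 0 := periodize_eqOn hT hclosed ⟨le_rfl, hT.le⟩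
  have hcont : ∀ Z, Continuous (X Z) := fun Z => (hX Z).choose_spec.continuous
  -- the neighbourhood consists of the regular points that lie over `W` if they are in the section;
  -- for regular points on `x = 1` the strict inequality defining the section may be replaced by the
  -- non-strict one, which makes the neighbourhood open
  refine ⟨⟨⟨periodize γ T, T, hT, hg, hgp, ?_, hrange.symm⟩, ?_⟩,
    regularSet X ∩ {z | z.1 = 1 ∧ 0 ≤ (X .C z).1 → z.2 ∈ W}, ?_, ?_, ?_⟩
  · obtain ⟨t, ht, hne⟩ := hnc
    exact ⟨t, by rwa [periodize_eqOn hT hclosed ht, h0]⟩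
  · rintro _ ⟨t, ht, rfl⟩ hz
    exact mem_crossingSet_of_regular (hreg t ht) hz
  · refine (isOpen_regularSet hcont).inter (isOpen_setOf_imp ?_ (hWo.preimage continuous_snd))
    exact (isClosed_eq continuous_fst continuous_const).inter
      (isClosed_le continuous_const (continuous_fst.comp (hcont _)))
  · rintro _ ⟨t, ht, rfl⟩
    refine ⟨hreg t ht, fun hz => ?_⟩
    have hr := (hreg t ht).1 ⟨by linarith [hz.1], hz.1.le⟩
    have hs : γ t ∈ upSection X := ⟨hz.1, lt_of_le_of_ne hz.2 hr.symm⟩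
    rcases ht.1.eq_or_lt with rfl | h1
    · rw [hγ0]; exact hh₀
    rcases ht.2.eq_or_lt with rfl | h2
    · rw [hγT]; exact hh₀
    · exact absurd hs (hns t ⟨h1, h2⟩)
  · rintro _ ⟨γ', T', hT', hγ', hp', -, rfl⟩ hsub
    have hreg' : ∀ t, γ' t ∈ regularSet X := fun t => (hsub (mem_range_self t)).1
    have hW' : ∀ t, γ' t ∈ upSection X → (γ' t).2 ∈ W := fun t ht =>
      (hsub (mem_range_self t)).2 ⟨ht.1, ht.2.le⟩
    obtain ⟨t₀, ht₀⟩ := hγ'.exists_mem_upSection hT' hp' hreg'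
    have hfx := hP.fixed_of_periodic hX hmono hγ' hT' hp' hW' ht₀
    have heq := (hfix _ (hW' _ ht₀)).1 hfx
    rw [← hrange]
    refine range_eq_of_mem_closed_path hX hT hT' hg hgp hγ' hp' (fun t => ?_)
      (by rw [h0, hγ0]; exact Prod.ext ht₀.1.symm heq.symm)
    have : periodize γ T t ∈ γ '' Icc 0 T := by rw [← hrange]; exact mem_range_self t
    obtain ⟨u, hu, he⟩ := this
    rw [← he]
    exact hreg u hu

end trajectories

/-! ### The perturbed fields and their explicit flows -/

/-- Parameters of a piecewise field of the form considered here: in each zone an isotropic dilation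
about the equilibrium is added to the unperturbed linear field, with rates `a`, `c`, `b` on the
right, in the centre and on the left, and the right saddle is moved from `(2, 0)` to
`(2 + X, Y)`. -/
structure DilationParams where
  a : ℝ
  X : ℝ
  Y : ℝ
  b : ℝ
  c : ℝ

/-- The piecewise field with the given dilation parameters. -/
def dilationField (e : DilationParams) : Zone → ℝ × ℝ → ℝ × ℝ
  | .L, z => ((z.1 + 3) + (z.2 - 2) + e.b * (z.1 + 3), -(z.2 - 2) + e.b * (z.2 - 2))
  | .C, z => (z.2 + e.c * z.1, -z.1 + e.c * z.2)
  | .R, z => ((z.2 - e.Y) + e.a * (z.1 - (2 + e.X)), (z.1 - (2 + e.X)) + e.a * (z.2 - e.Y))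

lemma exists_lipschitzWith_dilationField (e : DilationParams) (Z : Zone) :
    ∃ K, LipschitzWith K (dilationField e Z) := by
  have key : ∀ (A : ℝ × ℝ →L[ℝ] ℝ × ℝ) (v : ℝ × ℝ) (f : ℝ × ℝ → ℝ × ℝ),
      (∀ z, f z = A z + v) → ∃ K, LipschitzWith K f := fun A v f hf => by
    refine ⟨‖A‖₊, LipschitzWith.of_dist_le_mul fun x y => ?_⟩
    rw [hf, hf, dist_add_right]
    exact A.lipschitz.dist_le_mul x y
  let p := ContinuousLinearMap.fst ℝ ℝ ℝ
  let q := ContinuousLinearMap.snd ℝ ℝ ℝ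
  cases Z
  · refine key ((p + q + e.b • p).prod (-q + e.b • q)) (dilationField e .L 0) _ fun z => ?_
    ext <;> simp [dilationField, p, q] <;> ring
  · refine key ((q + e.c • p).prod (-p + e.c • q)) 0 _ fun z => ?_
    ext <;> simp [dilationField, p, q]
  · refine key ((q + e.a • p).prod (p + e.a • q)) (dilationField e .R 0) _ fun z => ?_
    ext <;> simp [dilationField, p, q] <;> ring

/-- For the dilated saddle flow `ξ' = η + a ξ`, `η' = ξ + a η`, this is `-ξ` along the solution
from `(-1, s)`. -/
noncomputable def saddleX (a s t : ℝ) : ℝ :=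
  ((1 - s) * Real.exp ((1 + a) * t) + (1 + s) * Real.exp ((a - 1) * t)) / 2

/-- For the dilated saddle flow `ξ' = η + a ξ`, `η' = ξ + a η`, this is `η` along the solution
from `(-1, s)`. -/
noncomputable def saddleY (a s t : ℝ) : ℝ :=
  (-(1 - s) * Real.exp ((1 + a) * t) + (1 + s) * Real.exp ((a - 1) * t)) / 2

/-- The time the saddle flow takes from `(-1, s)` to `(-1, -s')`, if it leads there. -/
noncomputable def saddleTime (s s' : ℝ) : ℝ :=
  (Real.log (1 + s) - Real.log (1 - s) + (Real.log (1 + s') - Real.log (1 - s'))) / 2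

/-- The function that vanishes if the saddle flow with dilation rate `a` leads from `(-1, s)` to
`(-1, -s')`: the difference of the values of the first integral. -/
noncomputable def saddleRel (a s s' : ℝ) : ℝ :=
  (1 + a) * Real.log (1 + s) + (1 - a) * Real.log (1 - s)
    - ((1 - a) * Real.log (1 + s') + (1 + a) * Real.log (1 - s'))

@[simp] lemma saddleX_zero (a s : ℝ) : saddleX a s 0 = 1 := by simp [saddleX]

@[simp] lemma saddleY_zero (a s : ℝ) : saddleY a s 0 = s := by simp [saddleY]; ring

lemma saddle_exp {a s s' : ℝ} (hs : s ∈ Ioo (0 : ℝ) 1) (hs' : s' ∈ Ioo (0 : ℝ) 1)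
    (h : saddleRel a s s' = 0) :
    Real.exp ((1 + a) * saddleTime s s') = (1 + s') / (1 - s) ∧
      Real.exp ((a - 1) * saddleTime s s') = (1 - s') / (1 + s) := by
  obtain ⟨h1, h2⟩ := hs
  obtain ⟨h3, h4⟩ := hs'
  unfold saddleRel at h
  constructor
  · rw [← Real.exp_log (show 0 < (1 + s') / (1 - s) by apply div_pos <;> linarith),
      Real.log_div (by linarith) (by linarith)]
    congr 1
    unfold saddleTime
    linarith
  · rw [← Real.exp_log (show 0 < (1 - s') / (1 + s) by apply div_pos <;> linarith),
      Real.log_div (by linarith) (by linarith)]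
    congr 1
    unfold saddleTime
    linarith

lemma saddleX_time {a s s' : ℝ} (hs : s ∈ Ioo (0 : ℝ) 1) (hs' : s' ∈ Ioo (0 : ℝ) 1)
    (h : saddleRel a s s' = 0) : saddleX a s (saddleTime s s') = 1 := by
  obtain ⟨e1, e2⟩ := saddle_exp hs hs' h
  have : 1 - s ≠ 0 := by linarith [hs.2]
  have : 1 + s ≠ 0 := by linarith [hs.1]
  rw [saddleX, e1, e2]
  field_simp
  ring

lemma saddleY_time {a s s' : ℝ} (hs : s ∈ Ioo (0 : ℝ) 1) (hs' : s' ∈ Ioo (0 : ℝ) 1)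
    (h : saddleRel a s s' = 0) : saddleY a s (saddleTime s s') = -s' := by
  obtain ⟨e1, e2⟩ := saddle_exp hs hs' h
  have : 1 - s ≠ 0 := by linarith [hs.2]
  have : 1 + s ≠ 0 := by linarith [hs.1]
  rw [saddleY, e1, e2]
  field_simp
  ring

lemma saddleTime_pos {s s' : ℝ} (hs : s ∈ Ioo (0 : ℝ) 1) (hs' : s' ∈ Ioo (0 : ℝ) 1) :
    0 < saddleTime s s' := by
  have h1 := Real.log_lt_log (by linarith [hs.2]) (show 1 - s < 1 + s by linarith [hs.1])
  have h2 := Real.log_lt_log (by linarith [hs'.2]) (show 1 - s' < 1 + s' by linarith [hs'.1])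
  unfold saddleTime
  linarith

lemma hasDerivAt_exp_mul (r t : ℝ) :
    HasDerivAt (fun t => Real.exp (r * t)) (r * Real.exp (r * t)) t := by
  have := ((hasDerivAt_id t).const_mul r).exp
  simpa [mul_comm] using this

lemma hasDerivAt_saddleX (a s t : ℝ) :
    HasDerivAt (saddleX a s) (a * saddleX a s t - saddleY a s t) t := by
  have := (((hasDerivAt_exp_mul (1 + a) t).const_mul (1 - s)).add
    ((hasDerivAt_exp_mul (a - 1) t).const_mul (1 + s))).div_const 2
  refine this.congr_deriv ?_
  simp only [saddleX, saddleY]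
  ring

lemma hasDerivAt_saddleY (a s t : ℝ) :
    HasDerivAt (saddleY a s) (a * saddleY a s t - saddleX a s t) t := by
  have := (((hasDerivAt_exp_mul (1 + a) t).const_mul (-(1 - s))).add
    ((hasDerivAt_exp_mul (a - 1) t).const_mul (1 + s))).div_const 2
  refine this.congr_deriv ?_
  simp only [saddleX, saddleY]
  ring

lemma saddleX_sub_saddleY_pos (a t : ℝ) {s : ℝ} (hs : s < 1) :
    0 < saddleX a s t - saddleY a s t := by
  have : saddleX a s t - saddleY a s t = (1 - s) * Real.exp ((1 + a) * t) := by
    simp only [saddleX, saddleY]; ring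
  rw [this]
  exact mul_pos (by linarith) (Real.exp_pos _)

lemma saddleX_add_saddleY_pos (a t : ℝ) {s : ℝ} (hs : -1 < s) :
    0 < saddleX a s t + saddleY a s t := by
  have : saddleX a s t + saddleY a s t = (1 + s) * Real.exp ((a - 1) * t) := by
    simp only [saddleX, saddleY]; ring
  rw [this]
  exact mul_pos (by linarith) (Real.exp_pos _)

lemma saddleX_lt_one {a s T t : ℝ} (ha : |a| < 1) (hs : s ∈ Ioo (0 : ℝ) 1)
    (hT : saddleX a s T = 1) (ht : t ∈ Ioo 0 T) : saddleX a s t < 1 := by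
  have hconv : StrictConvexOn ℝ univ (saddleX a s) := by
    refine strictConvexOn_univ_of_deriv2_pos
      (continuous_iff_continuousAt.2 fun t => (hasDerivAt_saddleX a s t).continuousAt) fun t => ?_
    have h1 : deriv (saddleX a s) = fun t => a * saddleX a s t - saddleY a s t :=
      funext fun t => (hasDerivAt_saddleX a s t).deriv
    have h2 : HasDerivAt (fun t => a * saddleX a s t - saddleY a s t) _ t :=
      ((hasDerivAt_saddleX a s t).const_mul a).sub (hasDerivAt_saddleY a s t)
    rw [Function.iterate_succ, Function.iterate_one, Function.comp_apply, h1, h2.deriv]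
    have p1 := saddleX_sub_saddleY_pos a t hs.2
    have p2 := saddleX_add_saddleY_pos a t (by linarith [hs.1] : -1 < s)
    obtain ⟨a1, a2⟩ := abs_lt.1 ha
    have q1 : 0 < (1 + a) ^ 2 * (saddleX a s t - saddleY a s t) :=
      mul_pos (pow_pos (by linarith) 2) p1
    have q2 : 0 < (1 - a) ^ 2 * (saddleX a s t + saddleY a s t) :=
      mul_pos (pow_pos (by linarith) 2) p2
    nlinarith
  have h0T : (0 : ℝ) < T := ht.1.trans ht.2
  have := hconv.lt_on_openSegment (mem_univ 0) (mem_univ T) h0T.ne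
    (by rw [openSegment_eq_Ioo h0T]; exact ht)
  simpa [hT] using this

/-- The solution of the right subsystem from `(1, h)`: the saddle flow, centred at `(2 + X, Y)` and
scaled by the distance `1 + X` of the saddle from the switching line. -/
noncomputable def arcR (e : DilationParams) (h t : ℝ) : ℝ × ℝ :=
  (2 + e.X - (1 + e.X) * saddleX e.a ((h - e.Y) / (1 + e.X)) t,
    e.Y + (1 + e.X) * saddleY e.a ((h - e.Y) / (1 + e.X)) t)

/-- The solution of the left subsystem from `(-1, -k)`: the linear map taking `(x + 3, y - 2)` to
`(-(x + 3) / 2, -(x + y + 1) / 2)` turns it into the saddle flow. -/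
noncomputable def arcL (e : DilationParams) (k t : ℝ) : ℝ × ℝ :=
  (-3 + 2 * saddleX e.b (k / 2) t, 2 - 2 * (saddleX e.b (k / 2) t + saddleY e.b (k / 2) t))

/-- The solution of the central subsystem from `(1, -k)`. -/
noncomputable def arcC (e : DilationParams) (k t : ℝ) : ℝ × ℝ :=
  (Real.exp (e.c * t) * (Real.cos t - k * Real.sin t),
    -(Real.exp (e.c * t) * (Real.sin t + k * Real.cos t)))

/-- The time of the passage through the right zone from `(1, h)` to `(1, -k)`. -/
noncomputable def timeR (e : DilationParams) (h k : ℝ) : ℝ :=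
  saddleTime ((h - e.Y) / (1 + e.X)) ((k + e.Y) / (1 + e.X))

/-- The time of the passage through the left zone from `(-1, -k)` to `(-1, h)`. -/
noncomputable def timeL (k h : ℝ) : ℝ := saddleTime (k / 2) (h / 2)

/-- The time of the passage through the central zone from `(1, -k)` to `(-1, -k')`: the angle by
which the position vector turns. -/
noncomputable def timeC (k k' : ℝ) : ℝ := Real.pi - Real.arctan k - Real.arctan k'

/-- Vanishes if the right subsystem leads from `(1, h)` to `(1, -k)`. -/
noncomputable def relR (e : DilationParams) (h k : ℝ) : ℝ :=
  saddleRel e.a ((h - e.Y) / (1 + e.X)) ((k + e.Y) / (1 + e.X))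

/-- Vanishes if the left subsystem leads from `(-1, -k)` to `(-1, h)`. -/
noncomputable def relL (e : DilationParams) (k h : ℝ) : ℝ := saddleRel e.b (k / 2) (h / 2)

/-- Vanishes if the central subsystem leads from `(1, -k)` to `(-1, -k')`, equivalently from
`(-1, k)` to `(1, k')`: the logarithm of `x² + y²` grows at the constant rate `2 c`. -/
noncomputable def relC (e : DilationParams) (k k' : ℝ) : ℝ :=
  Real.log (1 + k ^ 2) + 2 * e.c * timeC k k' - Real.log (1 + k' ^ 2)

/-- A consecutive chain of heights: an orbit starting at `(1, h₁)` passes through `(1, -h₂)`,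
`(-1, -h₃)`, `(-1, h₄)` and returns to the line `x = 1` at `(1, h₅)`. The inequalities say that
the parameters are small and guarantee that all these points are crossed transversally. -/
structure IsChain (e : DilationParams) (h₁ h₂ h₃ h₄ h₅ : ℝ) : Prop where
  a_lt : |e.a| < 1
  b_lt : |e.b| < 1
  X_gt : 0 < 1 + e.X
  h₁_sub_gt : |e.a| * (1 + e.X) < h₁ - e.Y
  h₁_sub_lt : h₁ - e.Y < 1 + e.X
  h₂_add_gt : |e.a| * (1 + e.X) < h₂ + e.Y
  h₂_add_lt : h₂ + e.Y < 1 + e.X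
  h₁_gt : |e.c| < h₁
  h₂_gt : |e.c| < h₂
  h₃_gt : |e.c| < h₃
  h₄_gt : |e.c| < h₄
  h₅_gt : |e.c| < h₅
  h₅_sub_gt : |e.a| * (1 + e.X) < h₅ - e.Y
  h₅_sub_lt : h₅ - e.Y < 1 + e.X
  h₂_lt : h₂ < 1
  h₃_lt : h₃ < 1
  h₄_lt : h₄ < 1
  h₃_gt_b : 2 * |e.b| < h₃
  h₄_gt_b : 2 * |e.b| < h₄
  relR_eq : relR e h₁ h₂ = 0
  relC_eq : relC e h₂ h₃ = 0
  relL_eq : relL e h₃ h₄ = 0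
  relC_eq' : relC e h₄ h₅ = 0

lemma hasDerivAt_arcR (e : DilationParams) (h t : ℝ) :
    HasDerivAt (arcR e h) (dilationField e .R (arcR e h t)) t := by
  have := (((hasDerivAt_saddleX e.a ((h - e.Y) / (1 + e.X)) t).const_mul (1 + e.X)).const_sub
    (2 + e.X)).prodMk
    (((hasDerivAt_saddleY e.a ((h - e.Y) / (1 + e.X)) t).const_mul (1 + e.X)).const_add e.Y)
  refine this.congr_deriv ?_
  ext <;> simp only [dilationField, arcR] <;> ring

lemma hasDerivAt_arcL (e : DilationParams) (k t : ℝ) :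
    HasDerivAt (arcL e k) (dilationField e .L (arcL e k t)) t := by
  have := (((hasDerivAt_saddleX e.b (k / 2) t).const_mul 2).const_add (-3)).prodMk
    ((((hasDerivAt_saddleX e.b (k / 2) t).add (hasDerivAt_saddleY e.b (k / 2) t)).const_mul
      2).const_sub 2)
  refine this.congr_deriv ?_
  ext <;> simp only [dilationField, arcL] <;> ring

lemma hasDerivAt_arcC (e : DilationParams) (k t : ℝ) :
    HasDerivAt (arcC e k) (dilationField e .C (arcC e k t)) t := by
  have := ((hasDerivAt_exp_mul e.c t).mul
      ((Real.hasDerivAt_cos t).sub ((Real.hasDerivAt_sin t).const_mul k))).prodMk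
    ((hasDerivAt_exp_mul e.c t).mul
      ((Real.hasDerivAt_sin t).add ((Real.hasDerivAt_cos t).const_mul k))).neg
  refine this.congr_deriv ?_
  ext <;> simp only [dilationField, arcC, Pi.add_apply, Pi.sub_apply] <;> ring

lemma isArc_of_hasDerivAt {X : Zone → ℝ × ℝ → ℝ × ℝ} {Z : Zone} {γ : ℝ → ℝ × ℝ} {s t : ℝ}
    (h : ∀ τ, HasDerivAt γ (X Z (γ τ)) τ) (hZ : ∀ τ ∈ Icc s t, γ τ ∈ Z.closedRegion) :
    IsArc X Z γ s t := fun τ hτ => ⟨hZ τ hτ, (h τ).hasDerivWithinAt⟩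

lemma timeC_pos_lt {k k' : ℝ} (hk : 0 < k) (hk' : 0 < k') :
    0 < timeC k k' ∧ timeC k k' < Real.pi := by
  have h1 := Real.arctan_lt_pi_div_two k
  have h2 := Real.arctan_lt_pi_div_two k'
  have h3 := Real.arctan_pos.2 hk
  have h4 := Real.arctan_pos.2 hk'
  unfold timeC
  constructor <;> linarith

lemma one_le_timeC {k k' : ℝ} (hk : k < 1) (hk' : k' < 1) : 1 ≤ timeC k k' := by
  have h1 := Real.arctan_strictMono hk
  have h2 := Real.arctan_strictMono hk'
  rw [Real.arctan_one] at h1 h2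
  have := Real.pi_gt_three
  unfold timeC
  linarith

lemma arcC_time {e : DilationParams} {k k' : ℝ} (h : relC e k k' = 0) (hk : 0 < k) (hk' : 0 < k') :
    arcC e k (timeC k k') = (-1, -k') := by
  have hp : 0 < 1 + k ^ 2 := by positivity
  have hp' : 0 < 1 + k' ^ 2 := by positivity
  have hexp : Real.exp (e.c * timeC k k') = √(1 + k' ^ 2) / √(1 + k ^ 2) := by
    rw [← Real.exp_log (show 0 < √(1 + k' ^ 2) / √(1 + k ^ 2) by positivity),
      Real.log_div (by positivity) (by positivity), Real.log_sqrt hp'.le, Real.log_sqrt hp.le]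
    congr 1
    unfold relC at h
    linarith
  have hT : timeC k k' = Real.pi - (Real.arctan k + Real.arctan k') := by unfold timeC; ring
  have hq : √(1 + k ^ 2) ^ 2 = 1 + k ^ 2 := Real.sq_sqrt hp.le
  have hq0 : √(1 + k ^ 2) ≠ 0 := by positivity
  have hq0' : √(1 + k' ^ 2) ≠ 0 := by positivity
  have hcos : Real.cos (timeC k k') = -(1 - k * k') / (√(1 + k ^ 2) * √(1 + k' ^ 2)) := by
    rw [hT, Real.cos_pi_sub, Real.cos_add, Real.cos_arctan, Real.cos_arctan, Real.sin_arctan,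
      Real.sin_arctan]
    field_simp
  have hsin : Real.sin (timeC k k') = (k + k') / (√(1 + k ^ 2) * √(1 + k' ^ 2)) := by
    rw [hT, Real.sin_pi_sub, Real.sin_add, Real.cos_arctan, Real.cos_arctan, Real.sin_arctan,
      Real.sin_arctan]
    field_simp
  rw [arcC, hexp, hcos, hsin]
  ext
  · simp only
    field_simp
    rw [hq]; ring
  · simp only
    field_simp
    rw [hq]; ring

/-- Along the lower central arc `x` decreases. As the arc turns by less than `π`, it suffices that
the horizontal velocity is negative at both ends. -/
lemma field_arcC_neg {e : DilationParams} {k k' t : ℝ} (h : relC e k k' = 0) (hk : |e.c| < k)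
    (hk' : |e.c| < k') (ht : t ∈ Icc 0 (timeC k k')) :
    (dilationField e .C (arcC e k t)).1 < 0 := by
  have k0 := (abs_nonneg _).trans_lt hk
  have k0' := (abs_nonneg _).trans_lt hk'
  obtain ⟨hT0, hTpi⟩ := timeC_pos_lt k0 k0'
  have hend := arcC_time h k0 k0'
  obtain ⟨c1, c2⟩ := abs_lt.1 hk
  obtain ⟨c1', c2'⟩ := abs_lt.1 hk'
  set T := timeC k k'
  set f : ℝ → ℝ := fun t => (1 + e.c * k) * Real.sin t + (k - e.c) * Real.cos t with hf
  have hfield : ∀ t, (dilationField e .C (arcC e k t)).1 = -(Real.exp (e.c * t) * f t) := by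
    intro t
    simp only [dilationField, arcC, hf]
    ring
  have hfT : 0 < f T := by
    have h1 := hfield T
    rw [hend] at h1
    simp only [dilationField] at h1
    by_contra! h2
    have := mul_nonpos_of_nonneg_of_nonpos (Real.exp_pos (e.c * T)).le h2
    linarith
  have hsT : 0 < Real.sin T := Real.sin_pos_of_pos_of_lt_pi hT0 hTpi
  -- `f` is a positive combination of `sin (T - t)` and `sin t`
  have hid : f t * Real.sin T = (k - e.c) * Real.sin (T - t) + f T * Real.sin t := by
    simp only [hf, Real.sin_sub]
    ring
  have hpos : 0 < f t := by
    have hs1 : 0 ≤ Real.sin t := Real.sin_nonneg_of_nonneg_of_le_pi ht.1 (by linarith [ht.2])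
    have hs2 : 0 ≤ Real.sin (T - t) :=
      Real.sin_nonneg_of_nonneg_of_le_pi (by linarith [ht.2]) (by linarith [ht.1])
    have : 0 < f t * Real.sin T := by
      rw [hid]
      rcases ht.1.eq_or_lt with h0 | h0
      · rw [← h0, sub_zero, Real.sin_zero, mul_zero, add_zero]
        exact mul_pos (by linarith) hsT
      · have : 0 < Real.sin t := Real.sin_pos_of_pos_of_lt_pi h0 (by linarith [ht.2])
        have h3 := mul_pos hfT this
        have h4 := mul_nonneg (by linarith : (0 : ℝ) ≤ k - e.c) hs2
        linarith
    exact pos_of_mul_pos_left this hsT.le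
  rw [hfield]
  exact neg_neg_of_pos (mul_pos (Real.exp_pos _) hpos)

lemma arcL_zero (e : DilationParams) (k : ℝ) : arcL e k 0 = (-1, -k) := by
  ext <;> simp only [arcL, saddleX_zero, saddleY_zero] <;> ring

@[simp] lemma arcC_zero (e : DilationParams) (k : ℝ) : arcC e k 0 = (1, -k) := by
  simp [arcC]

lemma arcC_fst_mem {e : DilationParams} {k k' t : ℝ} (h : relC e k k' = 0) (hk : |e.c| < k)
    (hk' : |e.c| < k') (ht : t ∈ Ioo 0 (timeC k k')) : (arcC e k t).1 ∈ Ioo (-1 : ℝ) 1 := by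
  have k0 := (abs_nonneg _).trans_lt hk
  have k0' := (abs_nonneg _).trans_lt hk'
  have hder : ∀ t, HasDerivAt (fun t => (arcC e k t).1) (dilationField e .C (arcC e k t)).1 t :=
    fun t => (hasFDerivAt_fst (𝕜 := ℝ) (p := arcC e k t)).comp_hasDerivAt t (hasDerivAt_arcC e k t)
  have hanti : StrictAntiOn (fun t => (arcC e k t).1) (Icc 0 (timeC k k')) := by
    refine strictAntiOn_of_deriv_neg (convex_Icc _ _)
      (fun t _ => (hder t).continuousAt.continuousWithinAt) fun t ht => ?_
    rw [(hder t).deriv]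
    exact field_arcC_neg h hk hk' (interior_subset ht)
  have h1 := hanti ⟨le_rfl, (ht.1.trans ht.2).le⟩ (Ioo_subset_Icc_self ht) ht.1
  have h2 := hanti (Ioo_subset_Icc_self ht) ⟨(ht.1.trans ht.2).le, le_rfl⟩ ht.2
  simp only [arcC_zero, arcC_time h k0 k0'] at h1 h2
  exact ⟨h2, h1⟩

lemma dilationField_C_neg (e : DilationParams) (z : ℝ × ℝ) :
    dilationField e .C (-z) = -dilationField e .C z := by
  ext <;> simp [dilationField] <;> ring

/-! ### The loop of a chain -/

section concat

variable {γ₁ γ₂ : ℝ → ℝ × ℝ} {T₁ T₂ : ℝ}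

lemma concat_Icc {S : Set (ℝ × ℝ)} (hm : γ₁ T₁ = γ₂ 0)
    (h₁ : ∀ t ∈ Icc 0 T₁, γ₁ t ∈ S) (h₂ : ∀ t ∈ Icc 0 T₂, γ₂ t ∈ S) :
    ∀ t ∈ Icc 0 (T₁ + T₂), concat γ₁ T₁ γ₂ t ∈ S := by
  intro t ht
  rcases le_total t T₁ with h | h
  · rw [concat_of_le h]
    exact h₁ t ⟨ht.1, h⟩
  · rw [concat_of_ge h hm]
    exact h₂ _ ⟨by linarith, by linarith [ht.2]⟩

lemma concat_Ioo {S : Set (ℝ × ℝ)} (h₁ : ∀ t ∈ Ioo 0 T₁, γ₁ t ∈ S) (hT : γ₁ T₁ ∈ S)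
    (h₂ : ∀ t ∈ Ioo 0 T₂, γ₂ t ∈ S) :
    ∀ t ∈ Ioo 0 (T₁ + T₂), concat γ₁ T₁ γ₂ t ∈ S := by
  intro t ht
  rcases lt_trichotomy t T₁ with h | h | h
  · rw [concat_of_le h.le]
    exact h₁ t ⟨ht.1, h⟩
  · rw [concat_of_le h.le, h]
    exact hT
  · rw [concat, if_neg (not_le.2 h)]
    exact h₂ _ ⟨by linarith, by linarith [ht.2]⟩

lemma image_concat (hT₁ : 0 ≤ T₁) (hT₂ : 0 ≤ T₂) (hm : γ₁ T₁ = γ₂ 0) :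
    concat γ₁ T₁ γ₂ '' Icc 0 (T₁ + T₂) = γ₁ '' Icc 0 T₁ ∪ γ₂ '' Icc 0 T₂ := by
  apply Subset.antisymm
  · rintro _ ⟨t, ht, rfl⟩
    exact concat_Icc hm (fun t ht => Or.inl ⟨t, ht, rfl⟩) (fun t ht => Or.inr ⟨t, ht, rfl⟩) t ht
  · rintro _ (⟨t, ht, rfl⟩ | ⟨t, ht, rfl⟩)
    · exact ⟨t, ⟨ht.1, by linarith [ht.2]⟩, concat_of_le ht.2⟩
    · refine ⟨t + T₁, ⟨by linarith [ht.1], by linarith [ht.2]⟩, ?_⟩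
      rw [concat_of_ge (by linarith [ht.1]) hm, add_sub_cancel_right]

lemma concat_zero (hT₁ : 0 ≤ T₁) : concat γ₁ T₁ γ₂ 0 = γ₁ 0 := concat_of_le hT₁

lemma concat_add (hT₂ : 0 ≤ T₂) (hm : γ₁ T₁ = γ₂ 0) : concat γ₁ T₁ γ₂ (T₁ + T₂) = γ₂ T₂ := by
  rw [concat_of_ge (by linarith) hm, add_sub_cancel_left]

end concat

/-- The curve through `(1, h₁)`, `(1, -h₂)`, `(-1, -h₃)`, `(-1, h₄)` back to `x = 1`. -/
noncomputable def loop (e : DilationParams) (h₁ h₂ h₃ h₄ : ℝ) : ℝ → ℝ × ℝ :=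
  concat (arcR e h₁) (timeR e h₁ h₂) (concat (arcC e h₂) (timeC h₂ h₃)
    (concat (arcL e h₃) (timeL h₃ h₄) fun t => -arcC e h₄ t))

/-- The time at which the loop is back on the line `x = 1`. -/
noncomputable def loopTime (e : DilationParams) (h₁ h₂ h₃ h₄ h₅ : ℝ) : ℝ :=
  timeR e h₁ h₂ + (timeC h₂ h₃ + (timeL h₃ h₄ + timeC h₄ h₅))

lemma abs_mul_lt_of_abs_lt_one {a y m : ℝ} (ha : |a| < 1) (hy : 0 < y) (hm : y < m) :
    |a * y| < m := by
  rw [abs_mul, abs_of_pos hy]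
  nlinarith

lemma regular_of_right {X : Zone → ℝ × ℝ → ℝ × ℝ} {y : ℝ}
    (h1 : 0 < (X .R (1, y)).1 * (X .C (1, y)).1) (h2 : (X .R (1, y)).2 < 0) :
    ((1 : ℝ), y) ∈ regularSet X := by
  refine ⟨fun _ h => ?_, fun h => ?_, fun _ => h1, fun _ => h2, fun h => ?_⟩
  · rw [h, mul_zero] at h1; exact h1.false
  · norm_num at h
  · norm_num at h

lemma regular_of_left {X : Zone → ℝ × ℝ → ℝ × ℝ} {y : ℝ}
    (h1 : 0 < (X .L (-1, y)).1 * (X .C (-1, y)).1) (h2 : 0 < (X .L (-1, y)).2) :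
    ((-1 : ℝ), y) ∈ regularSet X := by
  refine ⟨fun _ h => ?_, fun _ => h1, fun h => ?_, fun h => ?_, fun _ => h2⟩
  · rw [h, mul_zero] at h1; exact h1.false
  · norm_num at h
  · norm_num at h

namespace IsChain

variable {e : DilationParams} {h₁ h₂ h₃ h₄ h₅ : ℝ}

lemma regular_right_up (H : IsChain e h₁ h₂ h₃ h₄ h₅) {h : ℝ} (h1 : |e.a| * (1 + e.X) < h - e.Y)
    (h2 : h - e.Y < 1 + e.X) (h3 : |e.c| < h) :
    ((1 : ℝ), h) ∈ regularSet (dilationField e) ∧ ((1 : ℝ), h) ∈ upSection (dilationField e) := by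
  have hX := H.X_gt
  have ha1 : e.a * (1 + e.X) ≤ |e.a| * (1 + e.X) :=
    mul_le_mul_of_nonneg_right (le_abs_self _) hX.le
  have h0 : 0 < h - e.Y := (mul_nonneg (abs_nonneg _) hX.le).trans_lt h1
  have ha2 := abs_lt.1 (abs_mul_lt_of_abs_lt_one H.a_lt h0 h2)
  have hc := abs_lt.1 h3
  refine ⟨regular_of_right (mul_pos ?_ ?_) ?_, rfl, ?_⟩ <;> simp only [dilationField] <;>
    linarith

lemma regular_right_down (H : IsChain e h₁ h₂ h₃ h₄ h₅) :
    ((1 : ℝ), -h₂) ∈ regularSet (dilationField e) ∧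
      ((1 : ℝ), -h₂) ∉ upSection (dilationField e) := by
  have hX := H.X_gt
  have ha1 : -e.a * (1 + e.X) ≤ |e.a| * (1 + e.X) :=
    mul_le_mul_of_nonneg_right (neg_le_abs _) hX.le
  have h1 := H.h₂_add_gt
  have h0 : 0 < h₂ + e.Y := (mul_nonneg (abs_nonneg _) hX.le).trans_lt h1
  have ha2 := abs_lt.1 (abs_mul_lt_of_abs_lt_one H.a_lt h0 H.h₂_add_lt)
  have hc := abs_lt.1 H.h₂_gt
  refine ⟨regular_of_right (mul_pos_of_neg_of_neg ?_ ?_) ?_, fun h => absurd h.2 (not_lt.2 ?_)⟩ <;>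
    simp only [dilationField] <;> linarith

lemma regular_left_down (H : IsChain e h₁ h₂ h₃ h₄ h₅) :
    ((-1 : ℝ), -h₃) ∈ regularSet (dilationField e) := by
  have hb := abs_lt.1 H.b_lt
  have hb3 := H.h₃_gt_b
  have hb3' := le_abs_self e.b
  have hc := abs_lt.1 H.h₃_gt
  have h0 := (abs_nonneg _).trans_lt H.h₃_gt
  refine regular_of_left (mul_pos_of_neg_of_neg ?_ ?_) ?_ <;> simp only [dilationField]
  · linarith
  · linarith
  · nlinarith

lemma regular_left_up (H : IsChain e h₁ h₂ h₃ h₄ h₅) :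
    ((-1 : ℝ), h₄) ∈ regularSet (dilationField e) := by
  have hb := abs_lt.1 H.b_lt
  have hb3 := H.h₄_gt_b
  have hb3' := neg_le_abs e.b
  have hc := abs_lt.1 H.h₄_gt
  have h0 := H.h₄_lt
  refine regular_of_left (mul_pos ?_ ?_) ?_ <;> simp only [dilationField]
  · linarith
  · linarith
  · nlinarith

lemma ratio₁ (H : IsChain e h₁ h₂ h₃ h₄ h₅) : (h₁ - e.Y) / (1 + e.X) ∈ Ioo (0 : ℝ) 1 := by
  have hX := H.X_gt
  have h0 : 0 < h₁ - e.Y := (mul_nonneg (abs_nonneg _) hX.le).trans_lt H.h₁_sub_gt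
  exact ⟨div_pos h0 hX, (div_lt_one hX).2 H.h₁_sub_lt⟩

lemma ratio₂ (H : IsChain e h₁ h₂ h₃ h₄ h₅) : (h₂ + e.Y) / (1 + e.X) ∈ Ioo (0 : ℝ) 1 := by
  have hX := H.X_gt
  have h0 : 0 < h₂ + e.Y := (mul_nonneg (abs_nonneg _) hX.le).trans_lt H.h₂_add_gt
  exact ⟨div_pos h0 hX, (div_lt_one hX).2 H.h₂_add_lt⟩

lemma ratio₃ (H : IsChain e h₁ h₂ h₃ h₄ h₅) : h₃ / 2 ∈ Ioo (0 : ℝ) 1 :=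
  ⟨by linarith [(abs_nonneg _).trans_lt H.h₃_gt], by linarith [H.h₃_lt]⟩

lemma ratio₄ (H : IsChain e h₁ h₂ h₃ h₄ h₅) : h₄ / 2 ∈ Ioo (0 : ℝ) 1 :=
  ⟨by linarith [(abs_nonneg _).trans_lt H.h₄_gt], by linarith [H.h₄_lt]⟩

lemma arcR_zero (H : IsChain e h₁ h₂ h₃ h₄ h₅) : arcR e h₁ 0 = (1, h₁) := by
  have := H.X_gt.ne'
  ext <;> simp only [arcR, saddleX_zero, saddleY_zero] <;> field_simp <;> ring

lemma arcR_time (H : IsChain e h₁ h₂ h₃ h₄ h₅) : arcR e h₁ (timeR e h₁ h₂) = (1, -h₂) := by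
  have := H.X_gt.ne'
  simp only [arcR, timeR, saddleX_time H.ratio₁ H.ratio₂ H.relR_eq,
    saddleY_time H.ratio₁ H.ratio₂ H.relR_eq]
  ext <;> field_simp <;> ring

lemma arcL_time (H : IsChain e h₁ h₂ h₃ h₄ h₅) : arcL e h₃ (timeL h₃ h₄) = (-1, h₄) := by
  simp only [arcL, timeL, saddleX_time H.ratio₃ H.ratio₄ H.relL_eq,
    saddleY_time H.ratio₃ H.ratio₄ H.relL_eq]
  ext <;> simp only <;> ring

lemma h₂_pos (H : IsChain e h₁ h₂ h₃ h₄ h₅) : 0 < h₂ := (abs_nonneg _).trans_lt H.h₂_gt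
lemma h₃_pos (H : IsChain e h₁ h₂ h₃ h₄ h₅) : 0 < h₃ := (abs_nonneg _).trans_lt H.h₃_gt
lemma h₄_pos (H : IsChain e h₁ h₂ h₃ h₄ h₅) : 0 < h₄ := (abs_nonneg _).trans_lt H.h₄_gt
lemma h₅_pos (H : IsChain e h₁ h₂ h₃ h₄ h₅) : 0 < h₅ := (abs_nonneg _).trans_lt H.h₅_gt

lemma arcC_time₂ (H : IsChain e h₁ h₂ h₃ h₄ h₅) : arcC e h₂ (timeC h₂ h₃) = (-1, -h₃) :=
  arcC_time H.relC_eq H.h₂_pos H.h₃_pos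

lemma arcC_time₄ (H : IsChain e h₁ h₂ h₃ h₄ h₅) : arcC e h₄ (timeC h₄ h₅) = (-1, -h₅) :=
  arcC_time H.relC_eq' H.h₄_pos H.h₅_pos

lemma arcR_gt (H : IsChain e h₁ h₂ h₃ h₄ h₅) {t : ℝ} (ht : t ∈ Ioo 0 (timeR e h₁ h₂)) :
    1 < (arcR e h₁ t).1 := by
  have := saddleX_lt_one H.a_lt H.ratio₁ (saddleX_time H.ratio₁ H.ratio₂ H.relR_eq) ht
  have := mul_pos H.X_gt (sub_pos.2 this)
  simp only [arcR]
  linarith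

lemma arcL_lt (H : IsChain e h₁ h₂ h₃ h₄ h₅) {t : ℝ} (ht : t ∈ Ioo 0 (timeL h₃ h₄)) :
    (arcL e h₃ t).1 < -1 := by
  have := saddleX_lt_one H.b_lt H.ratio₃ (saddleX_time H.ratio₃ H.ratio₄ H.relL_eq) ht
  simp only [arcL]
  linarith

lemma arcR_regular (H : IsChain e h₁ h₂ h₃ h₄ h₅) {t : ℝ} (ht : t ∈ Ioo 0 (timeR e h₁ h₂)) :
    arcR e h₁ t ∈ regularSet (dilationField e) := by
  have hx := H.arcR_gt ht
  have p1 := saddleX_sub_saddleY_pos e.a t H.ratio₁.2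
  have p2 := saddleX_add_saddleY_pos e.a t (neg_one_lt_zero.trans H.ratio₁.1)
  obtain ⟨a1, a2⟩ := abs_lt.1 H.a_lt
  refine ⟨fun h => absurd h.2 (not_le.2 hx), fun h => by linarith, fun h => by linarith,
    fun _ => ?_, fun h => by linarith⟩
  set s := (h₁ - e.Y) / (1 + e.X)
  have : (dilationField e .R (arcR e h₁ t)).2
      = -((1 + e.X) * (((1 - e.a) * (saddleX e.a s t + saddleY e.a s t)
        + (1 + e.a) * (saddleX e.a s t - saddleY e.a s t)) / 2)) := by
    simp only [dilationField, arcR]; ring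
  rw [this, neg_lt_zero]
  have q1 : 0 < (1 - e.a) * (saddleX e.a s t + saddleY e.a s t) := mul_pos (by linarith) p2
  have q2 : 0 < (1 + e.a) * (saddleX e.a s t - saddleY e.a s t) := mul_pos (by linarith) p1
  exact mul_pos H.X_gt (by linarith)

lemma arcL_regular (H : IsChain e h₁ h₂ h₃ h₄ h₅) {t : ℝ} (ht : t ∈ Ioo 0 (timeL h₃ h₄)) :
    arcL e h₃ t ∈ regularSet (dilationField e) := by
  have hx := H.arcL_lt ht
  have p2 := saddleX_add_saddleY_pos e.b t (neg_one_lt_zero.trans H.ratio₃.1)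
  obtain ⟨b1, b2⟩ := abs_lt.1 H.b_lt
  refine ⟨fun h => absurd h.1 (not_le.2 hx), fun h => by linarith, fun h => by linarith,
    fun h => by linarith, fun _ => ?_⟩
  have : (dilationField e .L (arcL e h₃ t)).2
      = 2 * ((1 - e.b) * (saddleX e.b (h₃ / 2) t + saddleY e.b (h₃ / 2) t)) := by
    simp only [dilationField, arcL]; ring
  rw [this]
  have := mul_pos (by linarith : 0 < 1 - e.b) p2
  linarith

lemma arcC_regular {k k' : ℝ} (h : relC e k k' = 0) (hk : |e.c| < k)
    (hk' : |e.c| < k') {t : ℝ} (ht : t ∈ Ioo 0 (timeC k k')) :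
    arcC e k t ∈ regularSet (dilationField e) ∧ -arcC e k t ∈ regularSet (dilationField e) := by
  obtain ⟨x1, x2⟩ := arcC_fst_mem h hk hk' ht
  have hf := field_arcC_neg h hk hk' (Ioo_subset_Icc_self ht)
  constructor
  · exact ⟨fun _ => hf.ne, fun h => by linarith, fun h => by linarith, fun h => by linarith,
      fun h => by linarith⟩
  · have e1 : (-arcC e k t).1 = -(arcC e k t).1 := rfl
    refine ⟨fun _ => ?_, fun h => by linarith, fun h => by linarith, fun h => by linarith,
      fun h => by linarith⟩
    rw [dilationField_C_neg]
    exact neg_ne_zero.2 hf.ne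

lemma Icc_of_Ioo {γ : ℝ → ℝ × ℝ} {T : ℝ} {p q : ℝ × ℝ} {S : Set (ℝ × ℝ)} (h0 : γ 0 = p)
    (hT : γ T = q) (hp : p ∈ S) (hq : q ∈ S) (h : ∀ t ∈ Ioo 0 T, γ t ∈ S) :
    ∀ t ∈ Icc 0 T, γ t ∈ S := by
  intro t ht
  rcases ht.1.eq_or_lt with h1 | h1
  · rw [← h1, h0]; exact hp
  rcases ht.2.eq_or_lt with h2 | h2
  · rw [h2, hT]; exact hq
  · exact h t ⟨h1, h2⟩

/-- The loop of a chain is a path of the piecewise system from `(1, h₁)` to `(1, h₅)` that consists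
of regular points, visits all zones and meets the section only at its ends. -/
theorem loop_spec (H : IsChain e h₁ h₂ h₃ h₄ h₅) :
    1 ≤ loopTime e h₁ h₂ h₃ h₄ h₅ ∧
    IsPath (dilationField e) (loop e h₁ h₂ h₃ h₄) 0 (loopTime e h₁ h₂ h₃ h₄ h₅) ∧
    loop e h₁ h₂ h₃ h₄ 0 = (1, h₁) ∧
    loop e h₁ h₂ h₃ h₄ (loopTime e h₁ h₂ h₃ h₄ h₅) = (1, h₅) ∧
    (∀ t ∈ Icc 0 (loopTime e h₁ h₂ h₃ h₄ h₅),
      loop e h₁ h₂ h₃ h₄ t ∈ regularSet (dilationField e)) ∧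
    (∀ t ∈ Ioo 0 (loopTime e h₁ h₂ h₃ h₄ h₅),
      loop e h₁ h₂ h₃ h₄ t ∉ upSection (dilationField e)) ∧
    loop e h₁ h₂ h₃ h₄ '' Icc 0 (loopTime e h₁ h₂ h₃ h₄ h₅) =
      arcR e h₁ '' Icc 0 (timeR e h₁ h₂) ∪ (arcC e h₂ '' Icc 0 (timeC h₂ h₃) ∪
        (arcL e h₃ '' Icc 0 (timeL h₃ h₄) ∪ (fun t => -arcC e h₄ t) '' Icc 0 (timeC h₄ h₅))) ∧
    VisitsAllZones (loop e h₁ h₂ h₃ h₄ '' Icc 0 (loopTime e h₁ h₂ h₃ h₄ h₅)) := by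
  have tR : 0 < timeR e h₁ h₂ := saddleTime_pos H.ratio₁ H.ratio₂
  have tL : 0 < timeL h₃ h₄ := saddleTime_pos H.ratio₃ H.ratio₄
  have tC := timeC_pos_lt H.h₂_pos H.h₃_pos
  have tC' := timeC_pos_lt H.h₄_pos H.h₅_pos
  have tC1 := one_le_timeC H.h₂_lt H.h₃_lt
  -- the matching conditions
  have m₃ : arcL e h₃ (timeL h₃ h₄) = (fun t => -arcC e h₄ t) 0 := by
    simp [H.arcL_time]
  have z₃ := concat_zero (γ₁ := arcL e h₃) (γ₂ := fun t => -arcC e h₄ t) tL.le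
  have m₂ : arcC e h₂ (timeC h₂ h₃)
      = concat (arcL e h₃) (timeL h₃ h₄) (fun t => -arcC e h₄ t) 0 := by
    rw [z₃, H.arcC_time₂, arcL_zero]
  have z₂ := concat_zero (γ₁ := arcC e h₂)
    (γ₂ := concat (arcL e h₃) (timeL h₃ h₄) (fun t => -arcC e h₄ t)) tC.1.le
  have m₁ : arcR e h₁ (timeR e h₁ h₂) = concat (arcC e h₂) (timeC h₂ h₃)
      (concat (arcL e h₃) (timeL h₃ h₄) fun t => -arcC e h₄ t) 0 := by
    rw [z₂, H.arcR_time, arcC_zero]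
  -- the arcs stay in their zones
  have zR : ∀ t ∈ Icc 0 (timeR e h₁ h₂), arcR e h₁ t ∈ Zone.R.closedRegion :=
    Icc_of_Ioo H.arcR_zero H.arcR_time (le_refl (1 : ℝ)) (le_refl (1 : ℝ))
      fun t ht => (H.arcR_gt ht).le
  have zL : ∀ t ∈ Icc 0 (timeL h₃ h₄), arcL e h₃ t ∈ Zone.L.closedRegion :=
    Icc_of_Ioo (arcL_zero e h₃) H.arcL_time (le_refl (-1 : ℝ)) (le_refl (-1 : ℝ))
      fun t ht => (H.arcL_lt ht).le
  have c1 : (1 : ℝ) ∈ Icc (-1 : ℝ) 1 := by norm_num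
  have c2 : (-1 : ℝ) ∈ Icc (-1 : ℝ) 1 := by norm_num
  have zC : ∀ t ∈ Icc 0 (timeC h₂ h₃), arcC e h₂ t ∈ Zone.C.closedRegion :=
    Icc_of_Ioo (arcC_zero e h₂) H.arcC_time₂ c1 c2 fun t ht =>
      Ioo_subset_Icc_self (arcC_fst_mem H.relC_eq H.h₂_gt H.h₃_gt ht)
  have e0 : (fun t => -arcC e h₄ t) 0 = (-1, h₄) := by simp
  have eT : (fun t => -arcC e h₄ t) (timeC h₄ h₅) = (1, h₅) := by
    simp [H.arcC_time₄]
  have iC' : ∀ t ∈ Ioo 0 (timeC h₄ h₅), (-arcC e h₄ t).1 ∈ Ioo (-1 : ℝ) 1 := fun t ht => by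
    have := arcC_fst_mem H.relC_eq' H.h₄_gt H.h₅_gt ht
    exact ⟨by simpa using neg_lt_neg this.2, by simpa using neg_lt_neg this.1⟩
  have zC' : ∀ t ∈ Icc 0 (timeC h₄ h₅), -arcC e h₄ t ∈ Zone.C.closedRegion :=
    Icc_of_Ioo (γ := fun t => -arcC e h₄ t) e0 eT c2 c1 fun t ht =>
      Ioo_subset_Icc_self (iC' t ht)
  have pR := (isArc_of_hasDerivAt (X := dilationField e) (hasDerivAt_arcR e h₁) zR).isPath
  have pL := (isArc_of_hasDerivAt (X := dilationField e) (hasDerivAt_arcL e h₃) zL).isPath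
  have pC := (isArc_of_hasDerivAt (X := dilationField e) (hasDerivAt_arcC e h₂) zC).isPath
  have pC' := (isArc_of_hasDerivAt (X := dilationField e) (γ := fun t => -arcC e h₄ t)
    (fun t => by rw [dilationField_C_neg]; exact (hasDerivAt_arcC e h₄ t).neg) zC').isPath
  have u₅ := H.regular_right_up H.h₅_sub_gt H.h₅_sub_lt H.h₅_gt
  have u₁ := H.regular_right_up H.h₁_sub_gt H.h₁_sub_lt H.h₁_gt
  have him : loop e h₁ h₂ h₃ h₄ '' Icc 0 (loopTime e h₁ h₂ h₃ h₄ h₅) =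
      arcR e h₁ '' Icc 0 (timeR e h₁ h₂) ∪ (arcC e h₂ '' Icc 0 (timeC h₂ h₃) ∪
        (arcL e h₃ '' Icc 0 (timeL h₃ h₄) ∪ (fun t => -arcC e h₄ t) '' Icc 0 (timeC h₄ h₅))) := by
    rw [loop, loopTime, image_concat tR.le (by linarith) m₁, image_concat tC.1.le (by linarith) m₂,
      image_concat tL.le tC'.1.le m₃]
  refine ⟨by unfold loopTime; linarith, ?_, ?_, ?_, ?_, ?_, him, ?_⟩
  · exact pR.concat (pC.concat (pL.concat pC' tL.le tC'.1.le m₃) tC.1.le (by linarith) m₂) tR.le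
      (by linarith) m₁
  · rw [loop, concat_zero tR.le, H.arcR_zero]
  · rw [loop, loopTime, concat_add (by linarith) m₁, concat_add (by linarith) m₂,
      concat_add tC'.1.le m₃]
    exact eT
  · exact concat_Icc m₁
      (Icc_of_Ioo H.arcR_zero H.arcR_time u₁.1 H.regular_right_down.1 fun t => H.arcR_regular)
      (concat_Icc m₂ (Icc_of_Ioo (arcC_zero e h₂) H.arcC_time₂ H.regular_right_down.1
        H.regular_left_down fun t ht => (arcC_regular H.relC_eq H.h₂_gt H.h₃_gt ht).1)
      (concat_Icc m₃ (Icc_of_Ioo (arcL_zero e h₃) H.arcL_time H.regular_left_down H.regular_left_up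
        fun t => H.arcL_regular)
      (Icc_of_Ioo (γ := fun t => -arcC e h₄ t) e0 eT H.regular_left_up u₅.1
        fun t ht => (arcC_regular H.relC_eq' H.h₄_gt H.h₅_gt ht).2)))
  · have hne : ∀ z : ℝ × ℝ, z.1 ≠ 1 → z ∈ (upSection (dilationField e))ᶜ := fun z hz h => hz h.1
    exact concat_Ioo (fun t ht => hne _ (H.arcR_gt ht).ne')
      (by rw [H.arcR_time]; exact H.regular_right_down.2)
      (concat_Ioo (fun t ht => hne _ (arcC_fst_mem H.relC_eq H.h₂_gt H.h₃_gt ht).2.ne)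
        (by rw [H.arcC_time₂]; exact hne _ (by norm_num))
      (concat_Ioo (fun t ht => hne _ (by linarith [H.arcL_lt ht]))
        (by rw [H.arcL_time]; exact hne _ (by norm_num)) fun t ht => hne _ (iC' t ht).2.ne))
  · have mid : ∀ {T : ℝ}, 0 < T → T / 2 ∈ Ioo 0 T := fun h => ⟨by linarith, by linarith⟩
    rw [him]
    intro Z
    cases Z
    · exact ⟨_, Or.inr (Or.inr (Or.inl ⟨_, Ioo_subset_Icc_self (mid tL), rfl⟩)), H.arcL_lt (mid tL)⟩
    · exact ⟨_, Or.inr (Or.inl ⟨_, Ioo_subset_Icc_self (mid tC.1), rfl⟩),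
        arcC_fst_mem H.relC_eq H.h₂_gt H.h₃_gt (mid tC.1)⟩
    · exact ⟨_, Or.inl ⟨_, Ioo_subset_Icc_self (mid tR), rfl⟩, H.arcR_gt (mid tR)⟩

end IsChain

/-! ### The perturbation and the transition maps -/

/-- The perturbation by dilations of rates `p`, `c`, `b` in the right, central and left zone, about
the respective equilibria, and by the constant horizontal field `r` in the right zone. -/
def dilationPert (p r b c : ℝ) : Zone → AffinePert
  | .L => { p := b, q := 0, r := 3 * b, s := 0, u := b, v := -2 * b }
  | .C => { p := c, q := 0, r := 0, s := 0, u := c, v := 0 }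
  | .R => { p := p, q := 0, r := r - 2 * p, s := 0, u := p, v := 0 }

/-- The dilation parameters of the field perturbed by `ε` times `dilationPert p r b c`; the constant
field in the right zone moves the saddle. -/
noncomputable def pertParams (p r b c ε : ℝ) : DilationParams where
  a := ε * p
  X := ε ^ 2 * p * r / (1 - (ε * p) ^ 2)
  Y := -(ε * r) / (1 - (ε * p) ^ 2)
  b := ε * b
  c := ε * c

/-- The unperturbed field is linear about its equilibria `(-3, 2)`, `(0, 0)` and `(2, 0)`. -/
lemma hamField_eq (Z : Zone) (z : ℝ × ℝ) :
    hamField scsHam Z z = dilationField ⟨0, 0, 0, 0, 0⟩ Z z := by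
  have key : ∀ (A B C x : ℝ), deriv (fun x : ℝ => A * x ^ 2 + B * x + C) x = 2 * A * x + B := by
    intro A B C x
    have := (((hasDerivAt_pow 2 x).const_mul A).add ((hasDerivAt_id x).const_mul B)).add_const C
    refine (HasDerivAt.deriv (f := fun x : ℝ => A * x ^ 2 + B * x + C) this).trans ?_
    norm_num
    ring
  have ky : ∀ K : QuadHam, deriv (fun y => K.val z.1 y) z.2
      = K.b * z.2 + (K.a * z.1 + K.α) := by
    intro K
    have : (fun y => K.val z.1 y) = fun y => K.b / 2 * y ^ 2 + (K.a * z.1 + K.α) * y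
        + (-(K.c / 2 * z.1 ^ 2) - K.β * z.1) := by
      ext y; simp only [QuadHam.val]; ring
    rw [this, key]; ring
  have kx : ∀ K : QuadHam, deriv (fun x => K.val x z.2) z.1
      = -(K.c * z.1) + (K.a * z.2 - K.β) := by
    intro K
    have : (fun x => K.val x z.2) = fun x => -(K.c / 2) * x ^ 2 + (K.a * z.2 - K.β) * x
        + (K.b / 2 * z.2 ^ 2 + K.α * z.2) := by
      ext y; simp only [QuadHam.val]; ring
    rw [this, key]; ring
  simp only [hamField, kx, ky]
  cases Z <;> ext <;> simp [scsHam, normalForm, dilationField] <;> ring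

lemma pertField_eq {p r b c ε : ℝ} (h : 1 - (ε * p) ^ 2 ≠ 0) :
    pertField scsHam (dilationPert p r b c) ε = dilationField (pertParams p r b c ε) := by
  funext Z z
  rw [pertField, hamField_eq]
  have h' : 1 - ε ^ 2 * p ^ 2 ≠ 0 := by rwa [← mul_pow]
  cases Z <;> ext <;>
    simp [dilationField, dilationPert, pertParams, AffinePert.f, AffinePert.g] <;>
    field_simp <;> ring

@[simp] lemma pertParams_zero (p r b c : ℝ) : pertParams p r b c 0 = ⟨0, 0, 0, 0, 0⟩ := by
  simp [pertParams]

/-- A scalar implicit function theorem, for equations with parameters `(ε, h)` that at `ε = 0` have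
the solution `k = h`. -/
lemma exists_implicit {F : (ℝ × ℝ) × ℝ → ℝ} {h₀ d : ℝ} (hF : ContDiffAt ℝ ω F ((0, h₀), h₀))
    (hd : HasDerivAt (fun k => F ((0, h₀), k)) d h₀) (hd0 : d ≠ 0)
    (hdiag : ∀ h, F ((0, h), h) = 0) :
    ∃ φ : ℝ × ℝ → ℝ, ContDiffAt ℝ ω φ (0, h₀) ∧ (∀ᶠ h in 𝓝 h₀, φ (0, h) = h) ∧
      ∀ᶠ v in 𝓝 ((0 : ℝ), h₀), F (v, φ v) = 0 := by
  have hinv : (fderiv ℝ F ((0, h₀), h₀) ∘L .inr ℝ (ℝ × ℝ) ℝ).IsInvertible := by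
    have h1 : HasFDerivAt F (fderiv ℝ F ((0, h₀), h₀)) ((0, h₀), h₀) :=
      (hF.differentiableAt (by simp)).hasFDerivAt
    have h2 : HasFDerivAt (fun k : ℝ => F ((0, h₀), k))
        (fderiv ℝ F ((0, h₀), h₀) ∘L .inr ℝ (ℝ × ℝ) ℝ) h₀ :=
      HasFDerivAt.comp h₀ h1 (hasFDerivAt_prodMk_right (0, h₀) h₀)
    have h3 := h2.unique hd.hasFDerivAt
    rw [h3]
    refine ContinuousLinearMap.IsInvertible.of_inverse
      (g := ContinuousLinearMap.toSpanSingleton ℝ d⁻¹) ?_ ?_ <;>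
    · ext; simp [hd0]
  have hn : (ω : WithTop ℕ∞) ≠ 0 := by simp
  refine ⟨hF.implicitFunction hn hinv, hF.contDiffAt_implicitFunction hn hinv, ?_, ?_⟩
  · have h1 := hF.eventually_apply_eq_iff_implicitFunction hn hinv
    have h2 : Tendsto (fun h : ℝ => (((0 : ℝ), h), h)) (𝓝 h₀) (𝓝 ((0, h₀), h₀)) := by
      apply Continuous.tendsto; fun_prop
    filter_upwards [h2.eventually h1] with h hh
    exact hh.1 (by rw [hdiag, hdiag])
  · filter_upwards [hF.eventually_apply_implicitFunction hn hinv] with v hv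
    rw [hv, hdiag]

section transition

variable (p r b c : ℝ)

lemma relR_zero (h k : ℝ) : relR ⟨0, 0, 0, 0, 0⟩ h k =
    Real.log (1 + h) + Real.log (1 - h) - (Real.log (1 + k) + Real.log (1 - k)) := by
  simp [relR, saddleRel]

lemma relL_zero (h k : ℝ) : relL ⟨0, 0, 0, 0, 0⟩ h k =
    Real.log (1 + h / 2) + Real.log (1 - h / 2)
      - (Real.log (1 + k / 2) + Real.log (1 - k / 2)) := by
  simp [relL, saddleRel]

lemma relC_zero (h k : ℝ) : relC ⟨0, 0, 0, 0, 0⟩ h k =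
    Real.log (1 + h ^ 2) - Real.log (1 + k ^ 2) := by
  simp [relC]

lemma contDiffAt_relR {h : ℝ} (hh : h ∈ Ioo (0 : ℝ) 1) :
    ContDiffAt ℝ ω (fun w : (ℝ × ℝ) × ℝ => relR (pertParams p r b c w.1.1) w.1.2 w.2)
      ((0, h), h) := by
  obtain ⟨h0, h1⟩ := hh
  simp only [relR, saddleRel, pertParams]
  fun_prop (disch := (simp; try linarith))

lemma contDiffAt_relL {h : ℝ} (hh : h ∈ Ioo (0 : ℝ) 1) :
    ContDiffAt ℝ ω (fun w : (ℝ × ℝ) × ℝ => relL (pertParams p r b c w.1.1) w.1.2 w.2)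
      ((0, h), h) := by
  obtain ⟨h0, h1⟩ := hh
  simp only [relL, saddleRel, pertParams]
  fun_prop (disch := (simp; try linarith))

lemma contDiffAt_relC (h : ℝ) :
    ContDiffAt ℝ ω (fun w : (ℝ × ℝ) × ℝ => relC (pertParams p r b c w.1.1) w.1.2 w.2)
      ((0, h), h) := by
  have h0 : 1 + h ^ 2 ≠ 0 := by positivity
  simp only [relC, timeC, pertParams]
  have a1 : ContDiffAt ℝ ω (fun w : (ℝ × ℝ) × ℝ => Real.arctan w.1.2) ((0, h), h) :=
    (Real.contDiff_arctan (n := ω)).contDiffAt.comp _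
      (by fun_prop : ContDiffAt ℝ ω (fun w : (ℝ × ℝ) × ℝ => w.1.2) ((0, h), h))
  have a2 : ContDiffAt ℝ ω (fun w : (ℝ × ℝ) × ℝ => Real.arctan w.2) ((0, h), h) :=
    (Real.contDiff_arctan (n := ω)).contDiffAt.comp _
      (by fun_prop : ContDiffAt ℝ ω (fun w : (ℝ × ℝ) × ℝ => w.2) ((0, h), h))
  have a3 : ContDiffAt ℝ ω (fun w : (ℝ × ℝ) × ℝ => Real.log (1 + w.1.2 ^ 2)) ((0, h), h) := by
    fun_prop (disch := (simp; try assumption))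
  have a4 : ContDiffAt ℝ ω (fun w : (ℝ × ℝ) × ℝ => Real.log (1 + w.2 ^ 2)) ((0, h), h) := by
    fun_prop (disch := (simp; try assumption))
  have a5 : ContDiffAt ℝ ω (fun w : (ℝ × ℝ) × ℝ => 2 * (w.1.1 * c)) ((0, h), h) := by fun_prop
  exact (a3.add (a5.mul ((contDiffAt_const.sub a1).sub a2))).sub a4

lemma hasDerivAt_log_one_add {f : ℝ → ℝ} {f' x : ℝ} (hf : HasDerivAt f f' x) (h : 0 < 1 + f x) :
    HasDerivAt (fun t => Real.log (1 + f t)) (f' / (1 + f x)) x :=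
  (hf.const_add 1).log h.ne'

lemma hasDerivAt_log_one_sub {f : ℝ → ℝ} {f' x : ℝ} (hf : HasDerivAt f f' x) (h : 0 < 1 - f x) :
    HasDerivAt (fun t => Real.log (1 - f t)) (-f' / (1 - f x)) x :=
  (hf.const_sub 1).log h.ne'

lemma exists_transitionR {h : ℝ} (hh : h ∈ Ioo (0 : ℝ) 1) :
    ∃ φ : ℝ × ℝ → ℝ, ContDiffAt ℝ ω φ (0, h) ∧ (∀ᶠ x in 𝓝 h, φ (0, x) = x) ∧
      ∀ᶠ v in 𝓝 ((0 : ℝ), h), relR (pertParams p r b c v.1) v.2 (φ v) = 0 := by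
  obtain ⟨h0, h1⟩ := hh
  have hd : HasDerivAt (fun k => relR (pertParams p r b c 0) h k)
      (-(1 / (1 + h) + -1 / (1 - h))) h := by
    simp only [pertParams_zero, relR_zero]
    exact ((hasDerivAt_log_one_add (hasDerivAt_id h) (by simp; linarith)).add
      (hasDerivAt_log_one_sub (hasDerivAt_id h) (by simp; linarith))).const_sub _
  refine exists_implicit (contDiffAt_relR p r b c ⟨h0, h1⟩) hd ?_ fun x => ?_
  · have e1 : (1 + h) ≠ 0 := by linarith
    have e2 : (1 - h) ≠ 0 := by linarith
    have : -(1 / (1 + h) + -1 / (1 - h)) = 2 * h / ((1 + h) * (1 - h)) := by field_simp; ring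
    rw [this]
    exact div_ne_zero (by linarith) (mul_ne_zero e1 e2)
  · simp [relR_zero]

lemma exists_transitionL {h : ℝ} (hh : h ∈ Ioo (0 : ℝ) 1) :
    ∃ φ : ℝ × ℝ → ℝ, ContDiffAt ℝ ω φ (0, h) ∧ (∀ᶠ x in 𝓝 h, φ (0, x) = x) ∧
      ∀ᶠ v in 𝓝 ((0 : ℝ), h), relL (pertParams p r b c v.1) v.2 (φ v) = 0 := by
  obtain ⟨h0, h1⟩ := hh
  have hd : HasDerivAt (fun k => relL (pertParams p r b c 0) h k)
      (-(1 / 2 / (1 + h / 2) + -(1 / 2) / (1 - h / 2))) h := by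
    simp only [pertParams_zero, relL_zero]
    have hid : HasDerivAt (fun k : ℝ => k / 2) (1 / 2) h := (hasDerivAt_id h).div_const 2
    exact ((hasDerivAt_log_one_add hid (by linarith)).add
      (hasDerivAt_log_one_sub hid (by linarith))).const_sub _
  refine exists_implicit (contDiffAt_relL p r b c ⟨h0, h1⟩) hd ?_ fun x => ?_
  · have e1 : (1 + h / 2) ≠ 0 := by linarith
    have e2 : (1 - h / 2) ≠ 0 := by linarith
    have : -(1 / 2 / (1 + h / 2) + -(1 / 2) / (1 - h / 2))
        = h / 2 / ((1 + h / 2) * (1 - h / 2)) := by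
      rw [div_add_div _ _ e1 e2, ← neg_div]; congr 1; ring
    rw [this]
    exact div_ne_zero (by linarith) (mul_ne_zero e1 e2)
  · simp [relL_zero]

lemma exists_transitionC {h : ℝ} (hh : h ∈ Ioo (0 : ℝ) 1) :
    ∃ φ : ℝ × ℝ → ℝ, ContDiffAt ℝ ω φ (0, h) ∧ (∀ᶠ x in 𝓝 h, φ (0, x) = x) ∧
      ∀ᶠ v in 𝓝 ((0 : ℝ), h), relC (pertParams p r b c v.1) v.2 (φ v) = 0 := by
  obtain ⟨h0, h1⟩ := hh
  have hd : HasDerivAt (fun k => relC (pertParams p r b c 0) h k)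
      (-(2 * h / (1 + h ^ 2))) h := by
    simp only [pertParams_zero, relC_zero]
    exact (hasDerivAt_log_one_add (by simpa using hasDerivAt_pow 2 h) (by positivity)).const_sub _
  refine exists_implicit (contDiffAt_relC p r b c h) hd ?_ fun x => ?_
  · have : 0 < 2 * h / (1 + h ^ 2) := by positivity
    linarith
  · simp [relC_zero]

/-! ### First order expansion of the transition maps -/

lemma hasDerivAt_pertParams_Y : HasDerivAt (fun ε => (pertParams p r b c ε).Y) (-r) 0 := by
  have h1 : HasDerivAt (fun ε : ℝ => -(ε * r)) (-r) 0 := by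
    exact ((hasDerivAt_id (0 : ℝ)).mul_const r).neg.congr_deriv (by simp)
  have h2 : HasDerivAt (fun ε : ℝ => 1 - (ε * p) ^ 2) 0 0 := by
    simpa using ((((hasDerivAt_id (0 : ℝ)).mul_const p).pow 2).const_sub 1)
  exact (h1.div h2 (by simp)).congr_deriv (by simp)

lemma hasDerivAt_pertParams_X : HasDerivAt (fun ε => (pertParams p r b c ε).X) 0 0 := by
  have h1 : HasDerivAt (fun ε : ℝ => ε ^ 2 * p * r) 0 0 := by
    simpa using ((hasDerivAt_pow 2 (0 : ℝ)).mul_const p).mul_const r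
  have h2 : HasDerivAt (fun ε : ℝ => 1 - (ε * p) ^ 2) 0 0 := by
    simpa using ((((hasDerivAt_id (0 : ℝ)).mul_const p).pow 2).const_sub 1)
  exact (h1.div h2 (by simp)).congr_deriv (by simp)

/-- Derivative at `ε = 0` of the defect of the first integral along a saddle arc with dilation rate
`ε q`. -/
lemma hasDerivAt_saddleRel {q s₀ σ σ' : ℝ} {s s' : ℝ → ℝ} (hs₀ : s₀ ∈ Ioo (0 : ℝ) 1)
    (hs : HasDerivAt s σ 0) (hs' : HasDerivAt s' σ' 0) (h0 : s 0 = s₀) (h0' : s' 0 = s₀) :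
    HasDerivAt (fun ε => saddleRel (ε * q) (s ε) (s' ε))
      (2 * q * (Real.log (1 + s₀) - Real.log (1 - s₀))
        + (σ - σ') * (1 / (1 + s₀) - 1 / (1 - s₀))) 0 := by
  obtain ⟨a1, a2⟩ := hs₀
  have hq : HasDerivAt (fun ε : ℝ => ε * q) q 0 := by
    simpa using (hasDerivAt_id (0 : ℝ)).mul_const q
  have l1 := hasDerivAt_log_one_add hs (by rw [h0]; linarith)
  have l2 := hasDerivAt_log_one_sub hs (by rw [h0]; linarith)
  have l3 := hasDerivAt_log_one_add hs' (by rw [h0']; linarith)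
  have l4 := hasDerivAt_log_one_sub hs' (by rw [h0']; linarith)
  have := (((hq.const_add 1).mul l1).add ((hq.const_sub 1).mul l2)).sub
    (((hq.const_sub 1).mul l3).add ((hq.const_add 1).mul l4))
  refine this.congr_deriv ?_
  have e1 : (1 + s₀) ≠ 0 := by linarith
  have e2 : (1 - s₀) ≠ 0 := by linarith
  simp only [h0, h0', zero_mul, add_zero, sub_zero, one_mul]
  field_simp
  ring

lemma eq_zero_of_eventually_zero {f : ℝ → ℝ} {d x : ℝ} (hf : HasDerivAt f d x)
    (h : ∀ᶠ t in 𝓝 x, f t = 0) : d = 0 :=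
  hf.unique ((hasDerivAt_const x (0 : ℝ)).congr_of_eventuallyEq h)

/-- First order change `κ` of the height after the passage through the right zone. -/
lemma deriv_transitionR {h κ : ℝ} {k : ℝ → ℝ} (hh : h ∈ Ioo (0 : ℝ) 1) (hk : HasDerivAt k κ 0)
    (hk0 : k 0 = h) (hrel : ∀ᶠ ε in 𝓝 (0 : ℝ), relR (pertParams p r b c ε) h (k ε) = 0) :
    h * κ = 2 * r * h - p * ((1 - h ^ 2) * (Real.log (1 + h) - Real.log (1 - h))) := by
  have hY := hasDerivAt_pertParams_Y p r b c
  have hX := (hasDerivAt_pertParams_X p r b c).const_add 1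
  have hs : HasDerivAt (fun ε => (h - (pertParams p r b c ε).Y) / (1 + (pertParams p r b c ε).X))
      r 0 := by
    exact ((hY.const_sub h).div hX (by simp)).congr_deriv (by simp)
  have hs' : HasDerivAt (fun ε => (k ε + (pertParams p r b c ε).Y) / (1 + (pertParams p r b c ε).X))
      (κ - r) 0 := by
    exact ((hk.add hY).div hX (by simp)).congr_deriv (by simp [sub_eq_add_neg])
  have := hasDerivAt_saddleRel (q := p) hh hs hs' (by simp) (by simp [hk0])
  have h0 := eq_zero_of_eventually_zero this hrel
  obtain ⟨a1, a2⟩ := hh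
  have e1 : (1 + h) ≠ 0 := by linarith
  have e2 : (1 - h) ≠ 0 := by linarith
  field_simp at h0
  linarith

/-- First order change `κ' - κ` of the height during the passage through the left zone. -/
lemma deriv_transitionL {h κ κ' : ℝ} {k k' : ℝ → ℝ} (hh : h ∈ Ioo (0 : ℝ) 1)
    (hk : HasDerivAt k κ 0) (hk' : HasDerivAt k' κ' 0) (hk0 : k 0 = h) (hk0' : k' 0 = h)
    (hrel : ∀ᶠ ε in 𝓝 (0 : ℝ), relL (pertParams p r b c ε) (k ε) (k' ε) = 0) :
    h * (κ' - κ)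
      = -(4 * b * ((1 - (h / 2) ^ 2) * (Real.log (1 + h / 2) - Real.log (1 - h / 2)))) := by
  obtain ⟨a1, a2⟩ := hh
  have := hasDerivAt_saddleRel (q := b) (s₀ := h / 2) ⟨by linarith, by linarith⟩
    (hk.div_const 2) (hk'.div_const 2) (by rw [hk0]) (by rw [hk0'])
  have h0 := eq_zero_of_eventually_zero this hrel
  have e1 : (1 + h / 2) ≠ 0 := by linarith
  have e2 : (1 - h / 2) ≠ 0 := by linarith
  have e3 : 1 / (1 + h / 2) - 1 / (1 - h / 2) = -h / ((1 + h / 2) * (1 - h / 2)) := by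
    rw [div_sub_div _ _ e1 e2]; congr 1; ring
  rw [e3, mul_div_assoc', add_div' _ _ _ (mul_ne_zero e1 e2), div_eq_zero_iff] at h0
  rcases h0 with h0 | h0
  · linarith
  · exact absurd h0 (mul_ne_zero e1 e2)

/-- First order change `κ' - κ` of the height during a passage through the central zone. -/
lemma deriv_transitionC {h κ κ' : ℝ} {k k' : ℝ → ℝ}
    (hk : HasDerivAt k κ 0) (hk' : HasDerivAt k' κ' 0) (hk0 : k 0 = h) (hk0' : k' 0 = h)
    (hrel : ∀ᶠ ε in 𝓝 (0 : ℝ), relC (pertParams p r b c ε) (k ε) (k' ε) = 0) :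
    h * (κ' - κ) = c * ((1 + h ^ 2) * (Real.pi - 2 * Real.arctan h)) := by
  have hp : 0 < 1 + h ^ 2 := by positivity
  have hc : HasDerivAt (fun ε : ℝ => 2 * (ε * c)) (2 * c) 0 := by
    simpa using ((hasDerivAt_id (0 : ℝ)).mul_const c).const_mul 2
  have := ((hasDerivAt_log_one_add (hk.pow 2) (by simp [hk0]; exact hp)).add
    (hc.mul ((hk.arctan.const_sub Real.pi).sub hk'.arctan))).sub
    (hasDerivAt_log_one_add (hk'.pow 2) (by simp [hk0']; exact hp))
  have h0 := eq_zero_of_eventually_zero this hrel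
  simp [hk0, hk0'] at h0
  field_simp at h0
  linarith

end transition

/-! ### Chains near an unperturbed orbit -/

lemma isChain_zero {h : ℝ} (hh : h ∈ Ioo (0 : ℝ) 1) : IsChain ⟨0, 0, 0, 0, 0⟩ h h h h h := by
  obtain ⟨h0, h1⟩ := hh
  constructor <;>
    simp [relR_zero, relL_zero, relC_zero, h0, h1]

/-- The orbit through `(1, h)` of the unperturbed system. -/
def unperturbedOrbit (h : ℝ) : Set (ℝ × ℝ) :=
  loop ⟨0, 0, 0, 0, 0⟩ h h h h '' Icc 0 (loopTime ⟨0, 0, 0, 0, 0⟩ h h h h h)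

/-- The Melnikov function of the perturbation `dilationPert p r b c`: it is `h` times the
derivative of the return map with respect to `ε` at `ε = 0`. -/
noncomputable def melnikov (p r b c h : ℝ) : ℝ :=
  2 * r * h - p * ((1 - h ^ 2) * (Real.log (1 + h) - Real.log (1 - h)))
    - 4 * b * ((1 - (h / 2) ^ 2) * (Real.log (1 + h / 2) - Real.log (1 - h / 2)))
    + 2 * c * ((1 + h ^ 2) * (Real.pi - 2 * Real.arctan h))

section limitCycles

variable (p r b c : ℝ)

lemma continuousAt_pertParams (h₀ : ℝ) :
    ContinuousAt (fun v : ℝ × ℝ => (pertParams p r b c v.1).a) (0, h₀) ∧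
    ContinuousAt (fun v : ℝ × ℝ => (pertParams p r b c v.1).X) (0, h₀) ∧
    ContinuousAt (fun v : ℝ × ℝ => (pertParams p r b c v.1).Y) (0, h₀) ∧
    ContinuousAt (fun v : ℝ × ℝ => (pertParams p r b c v.1).b) (0, h₀) ∧
    ContinuousAt (fun v : ℝ × ℝ => (pertParams p r b c v.1).c) (0, h₀) := by
  simp only [pertParams]
  refine ⟨?_, ?_, ?_, ?_, ?_⟩ <;> fun_prop (disch := simp)

/-- Near an unperturbed orbit, the heights at which the perturbed orbits hit the switching lines
are analytic functions of `ε` and the initial height. -/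
theorem exists_chain {h₀ : ℝ} (hh : h₀ ∈ Ioo (0 : ℝ) 1) :
    ∃ k₂ k₃ k₄ k₅ : ℝ × ℝ → ℝ,
      (ContDiffAt ℝ ω k₂ (0, h₀) ∧ ContDiffAt ℝ ω k₃ (0, h₀) ∧ ContDiffAt ℝ ω k₄ (0, h₀) ∧
        ContDiffAt ℝ ω k₅ (0, h₀)) ∧
      (∀ᶠ h in 𝓝 h₀, k₂ (0, h) = h ∧ k₃ (0, h) = h ∧ k₄ (0, h) = h ∧ k₅ (0, h) = h) ∧
      ∀ᶠ v in 𝓝 ((0 : ℝ), h₀),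
        IsChain (pertParams p r b c v.1) v.2 (k₂ v) (k₃ v) (k₄ v) (k₅ v) := by
  obtain ⟨φ₁, c₁, d₁, r₁⟩ := exists_transitionR p r b c hh
  obtain ⟨φ₂, c₂, d₂, r₂⟩ := exists_transitionC p r b c hh
  obtain ⟨φ₃, c₃, d₃, r₃⟩ := exists_transitionL p r b c hh
  have hfst : ContDiffAt ℝ ω (fun v : ℝ × ℝ => v.1) (0, h₀) := contDiffAt_fst
  have e₂ : φ₁ (0, h₀) = h₀ := d₁.self_of_nhds
  have C₂ := c₁
  have C₃ : ContDiffAt ℝ ω (fun v : ℝ × ℝ => φ₂ (v.1, φ₁ v)) (0, h₀) :=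
    ContDiffAt.comp (0, h₀) (by simpa [e₂] using c₂) (hfst.prodMk C₂)
  have e₃ : φ₂ (0, φ₁ (0, h₀)) = h₀ := by rw [e₂]; exact d₂.self_of_nhds
  have C₄ : ContDiffAt ℝ ω (fun v : ℝ × ℝ => φ₃ (v.1, φ₂ (v.1, φ₁ v))) (0, h₀) :=
    ContDiffAt.comp (0, h₀) (by simpa [e₃] using c₃) (hfst.prodMk C₃)
  have e₄ : φ₃ (0, φ₂ (0, φ₁ (0, h₀))) = h₀ := by rw [e₃]; exact d₃.self_of_nhds
  have C₅ : ContDiffAt ℝ ω (fun v : ℝ × ℝ => φ₂ (v.1, φ₃ (v.1, φ₂ (v.1, φ₁ v)))) (0, h₀) :=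
    ContDiffAt.comp (0, h₀) (by simpa [e₄] using c₂) (hfst.prodMk C₄)
  have e₅ : φ₂ (0, φ₃ (0, φ₂ (0, φ₁ (0, h₀)))) = h₀ := by rw [e₄]; exact d₂.self_of_nhds
  refine ⟨φ₁, fun v => φ₂ (v.1, φ₁ v), fun v => φ₃ (v.1, φ₂ (v.1, φ₁ v)),
    fun v => φ₂ (v.1, φ₃ (v.1, φ₂ (v.1, φ₁ v))), ⟨C₂, C₃, C₄, C₅⟩, ?_, ?_⟩
  · filter_upwards [d₁, d₂, d₃] with h h1 h2 h3
    simp [h1, h2, h3]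
  set k₂ := φ₁
  set k₃ : ℝ × ℝ → ℝ := fun v => φ₂ (v.1, φ₁ v) with hk₃
  set k₄ : ℝ × ℝ → ℝ := fun v => φ₃ (v.1, φ₂ (v.1, φ₁ v)) with hk₄
  set k₅ : ℝ × ℝ → ℝ := fun v => φ₂ (v.1, φ₃ (v.1, φ₂ (v.1, φ₁ v))) with hk₅
  have t : ∀ k : ℝ × ℝ → ℝ, ContinuousAt k (0, h₀) → k (0, h₀) = h₀ →
      Tendsto (fun v : ℝ × ℝ => (v.1, k v)) (𝓝 (0, h₀)) (𝓝 (0, h₀)) := fun k hk he => by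
    have := continuousAt_fst.prodMk hk
    rwa [ContinuousAt, he] at this
  have R₂ := (t k₂ C₂.continuousAt e₂).eventually r₂
  have R₃ := (t k₃ C₃.continuousAt e₃).eventually r₃
  have R₄ := (t k₄ C₄.continuousAt e₄).eventually r₂
  have E₃ : k₃ (0, h₀) = h₀ := e₃
  have E₄ : k₄ (0, h₀) = h₀ := e₄
  have E₅ : k₅ (0, h₀) = h₀ := e₅
  have H := isChain_zero hh
  obtain ⟨pa, pX, pY, pb, pc⟩ := continuousAt_pertParams p r b c h₀
  have q₁ : ContinuousAt (fun v : ℝ × ℝ => v.2) (0, h₀) := continuousAt_snd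
  have q₂ := C₂.continuousAt
  have q₃ := C₃.continuousAt
  have q₄ := C₄.continuousAt
  have q₅ := C₅.continuousAt
  have p0 := pertParams_zero p r b c
  have aX := pa.abs.mul (pX.const_add 1)
  have k1 : ContinuousAt (fun _ : ℝ × ℝ => (1 : ℝ)) (0, h₀) := continuousAt_const
  have b2 := pb.abs.const_mul 2
  have k0 : ContinuousAt (fun _ : ℝ × ℝ => (0 : ℝ)) (0, h₀) := continuousAt_const
  filter_upwards [r₁, R₂, R₃, R₄,
    pa.abs.eventually_lt k1 (by simp),
    pb.abs.eventually_lt k1 (by simp),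
    k0.eventually_lt (pX.const_add 1) (by simp),
    aX.eventually_lt (q₁.sub pY) (by simpa [p0] using H.h₁_sub_gt),
    (q₁.sub pY).eventually_lt (pX.const_add 1) (by simpa [p0] using H.h₁_sub_lt),
    aX.eventually_lt (q₂.add pY) (by simpa [p0, e₂] using H.h₂_add_gt),
    (q₂.add pY).eventually_lt (pX.const_add 1) (by simpa [p0, e₂] using H.h₂_add_lt),
    pc.abs.eventually_lt q₁ (by simpa [p0] using H.h₁_gt),
    pc.abs.eventually_lt q₂ (by simpa [p0, e₂] using H.h₂_gt),
    pc.abs.eventually_lt q₃ (by simpa [p0, E₃] using H.h₃_gt),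
    pc.abs.eventually_lt q₄ (by simpa [p0, E₄] using H.h₄_gt),
    pc.abs.eventually_lt q₅ (by simpa [p0, E₅] using H.h₅_gt),
    aX.eventually_lt (q₅.sub pY) (by simpa [p0, E₅] using H.h₅_sub_gt),
    (q₅.sub pY).eventually_lt (pX.const_add 1) (by simpa [p0, E₅] using H.h₅_sub_lt),
    q₂.eventually_lt k1 (by simpa [e₂] using H.h₂_lt),
    q₃.eventually_lt k1 (by simpa [E₃] using H.h₃_lt),
    q₄.eventually_lt k1 (by simpa [E₄] using H.h₄_lt),
    b2.eventually_lt q₃ (by simpa [p0, E₃] using H.h₃_gt_b),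
    b2.eventually_lt q₄ (by simpa [p0, E₄] using H.h₄_gt_b)]
    with v u1 u2 u3 u4 w1 w2 w3 w4 w5 w6 w7 w8 w9 w10 w11 w12 w13 w14 w15 w16 w17 w18 w19
  exact ⟨w1, w2, w3, w4, w5, w6, w7, w8, w9, w10, w11, w12, w13, w14, w15, w16, w17, w18, w19,
    u1, u2, u3, u4⟩

/-- The first order expansion of the return map. -/
lemma hasDerivAt_return {h : ℝ} (hh : h ∈ Ioo (0 : ℝ) 1) {k₂ k₃ k₄ k₅ : ℝ × ℝ → ℝ}
    (c₂ : ContDiffAt ℝ ω k₂ (0, h)) (c₃ : ContDiffAt ℝ ω k₃ (0, h))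
    (c₄ : ContDiffAt ℝ ω k₄ (0, h)) (c₅ : ContDiffAt ℝ ω k₅ (0, h))
    (hk : k₂ (0, h) = h ∧ k₃ (0, h) = h ∧ k₄ (0, h) = h ∧ k₅ (0, h) = h)
    (H : ∀ᶠ v in 𝓝 ((0 : ℝ), h),
      IsChain (pertParams p r b c v.1) v.2 (k₂ v) (k₃ v) (k₄ v) (k₅ v)) :
    HasDerivAt (fun ε => k₅ (ε, h)) (melnikov p r b c h / h) 0 := by
  have hd : ∀ {k : ℝ × ℝ → ℝ}, ContDiffAt ℝ ω k (0, h) →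
      HasDerivAt (fun ε => k (ε, h)) (deriv (fun ε => k (ε, h)) 0) 0 := fun {k} hk => by
    have h1 := hk.differentiableAt (by simp)
    have h2 : DifferentiableAt ℝ (fun ε : ℝ => (ε, h)) 0 := by fun_prop
    exact (DifferentiableAt.comp (0 : ℝ) h1 h2).hasDerivAt
  have d₂ := hd c₂
  have d₃ := hd c₃
  have d₄ := hd c₄
  have d₅ := hd c₅
  have ht : Tendsto (fun ε : ℝ => (ε, h)) (𝓝 0) (𝓝 (0, h)) := by
    apply Continuous.tendsto; fun_prop
  have H' := ht.eventually H
  have m₁ := deriv_transitionR p r b c hh d₂ hk.1 (H'.mono fun _ h => h.relR_eq)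
  have m₂ := deriv_transitionC p r b c d₂ d₃ hk.1 hk.2.1 (H'.mono fun _ h => h.relC_eq)
  have m₃ := deriv_transitionL p r b c hh d₃ d₄ hk.2.1 hk.2.2.1 (H'.mono fun _ h => h.relL_eq)
  have m₄ := deriv_transitionC p r b c d₄ d₅ hk.2.2.1 hk.2.2.2 (H'.mono fun _ h => h.relC_eq')
  refine d₅.congr_deriv ?_
  rw [eq_div_iff hh.1.ne', melnikov]
  linarith

/-- Compact pieces of trajectories depend continuously on parameters. After rescaling time to
`[0, 1]` the parameter intervals agree, and compactness gives uniform closeness. -/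
lemma eventually_image_subset_thickening {Ψ : (ℝ × ℝ) → ℝ → ℝ × ℝ} {T : ℝ × ℝ → ℝ} {v₀ : ℝ × ℝ}
    (hT₀ : 0 ≤ T v₀) (hΨ : ∀ t, ContinuousAt (fun w : (ℝ × ℝ) × ℝ => Ψ w.1 w.2) (v₀, t))
    (hT : ContinuousAt T v₀) {δ : ℝ} (hδ : 0 < δ) :
    ∀ᶠ v in 𝓝 v₀, Ψ v '' Icc 0 (T v) ⊆ Metric.thickening δ (Ψ v₀ '' Icc 0 (T v₀)) := by
  have key : ∀ᶠ v in 𝓝 v₀, ∀ σ ∈ Icc (0 : ℝ) 1, dist (Ψ v (σ * T v)) (Ψ v₀ (σ * T v₀)) < δ := by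
    refine isCompact_Icc.eventually_forall_of_forall_eventually fun σ _ => ?_
    have hT' : ContinuousAt (fun w : (ℝ × ℝ) × ℝ => T w.1) (v₀, σ) :=
      ContinuousAt.comp (x := (v₀, σ)) hT continuousAt_fst
    have g1 : ContinuousAt (fun w : (ℝ × ℝ) × ℝ => Ψ w.1 (w.2 * T w.1)) (v₀, σ) :=
      ContinuousAt.comp (x := (v₀, σ)) (g := fun w : (ℝ × ℝ) × ℝ => Ψ w.1 w.2)
        (f := fun w : (ℝ × ℝ) × ℝ => (w.1, w.2 * T w.1)) (hΨ (σ * T v₀))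
        (continuousAt_fst.prodMk (continuousAt_snd.mul hT'))
    have g2 : ContinuousAt (fun w : (ℝ × ℝ) × ℝ => Ψ v₀ (w.2 * T v₀)) (v₀, σ) :=
      ContinuousAt.comp (x := (v₀, σ)) (g := fun w : (ℝ × ℝ) × ℝ => Ψ w.1 w.2)
        (f := fun w : (ℝ × ℝ) × ℝ => (v₀, w.2 * T v₀)) (hΨ (σ * T v₀))
        (continuousAt_const.prodMk (continuousAt_snd.mul continuousAt_const))
    exact (g1.dist g2).eventually_lt continuousAt_const (by simpa using hδ)
  filter_upwards [key] with v hv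
  rintro _ ⟨t, ht, rfl⟩
  obtain ⟨σ, hσ, rfl⟩ : ∃ σ ∈ Icc (0 : ℝ) 1, σ * T v = t := by
    rcases (ht.1.trans ht.2).eq_or_lt with h | h
    · exact ⟨0, by simp, by rw [zero_mul]; exact le_antisymm ht.1 (by rw [h]; exact ht.2)⟩
    · exact ⟨t / T v, ⟨div_nonneg ht.1 h.le, (div_le_one h).2 ht.2⟩, div_mul_cancel₀ _ h.ne'⟩
  exact Metric.mem_thickening_iff.2 ⟨_, ⟨σ * T v₀, ⟨mul_nonneg hσ.1 hT₀,
    mul_le_of_le_one_left hT₀ hσ.2⟩, rfl⟩, hv σ hσ⟩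

section continuity

variable {α : Type*} [TopologicalSpace α] {x : α}

lemma continuousAt_saddleX {a s t : α → ℝ} (ha : ContinuousAt a x) (hs : ContinuousAt s x)
    (ht : ContinuousAt t x) : ContinuousAt (fun y => saddleX (a y) (s y) (t y)) x := by
  simp only [saddleX]
  fun_prop

lemma continuousAt_saddleY {a s t : α → ℝ} (ha : ContinuousAt a x) (hs : ContinuousAt s x)
    (ht : ContinuousAt t x) : ContinuousAt (fun y => saddleY (a y) (s y) (t y)) x := by
  simp only [saddleY]
  fun_prop

lemma continuousAt_saddleTime {s s' : α → ℝ} (hs : ContinuousAt s x) (hs' : ContinuousAt s' x)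
    (h0 : s x ∈ Ioo (0 : ℝ) 1) (h0' : s' x ∈ Ioo (0 : ℝ) 1) :
    ContinuousAt (fun y => saddleTime (s y) (s' y)) x := by
  have a1 : 1 + s x ≠ 0 := by linarith [h0.1]
  have a2 : 1 - s x ≠ 0 := by linarith [h0.2]
  have a3 : 1 + s' x ≠ 0 := by linarith [h0'.1]
  have a4 : 1 - s' x ≠ 0 := by linarith [h0'.2]
  exact ((((hs.const_add 1).log a1).sub ((continuousAt_const.sub hs).log a2)).add
    (((hs'.const_add 1).log a3).sub ((continuousAt_const.sub hs').log a4))).div_const 2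

end continuity

/-- The loops of nearby chains are close to the unperturbed orbit. -/
lemma eventually_loop_subset_thickening {h₀ : ℝ} (hh : h₀ ∈ Ioo (0 : ℝ) 1)
    {k₂ k₃ k₄ k₅ : ℝ × ℝ → ℝ} (c₂ : ContinuousAt k₂ (0, h₀)) (c₃ : ContinuousAt k₃ (0, h₀))
    (c₄ : ContinuousAt k₄ (0, h₀)) (c₅ : ContinuousAt k₅ (0, h₀))
    (hk : k₂ (0, h₀) = h₀ ∧ k₃ (0, h₀) = h₀ ∧ k₄ (0, h₀) = h₀ ∧ k₅ (0, h₀) = h₀)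
    (H : ∀ᶠ v in 𝓝 ((0 : ℝ), h₀),
      IsChain (pertParams p r b c v.1) v.2 (k₂ v) (k₃ v) (k₄ v) (k₅ v)) {δ : ℝ} (hδ : 0 < δ) :
    ∀ᶠ v in 𝓝 ((0 : ℝ), h₀), loop (pertParams p r b c v.1) v.2 (k₂ v) (k₃ v) (k₄ v) ''
      Icc 0 (loopTime (pertParams p r b c v.1) v.2 (k₂ v) (k₃ v) (k₄ v) (k₅ v)) ⊆
        Metric.thickening δ (unperturbedOrbit h₀) := by
  obtain ⟨e₂, e₃, e₄, e₅⟩ := hk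
  have H₀ := isChain_zero hh
  obtain ⟨pa, pX, pY, pb, pc⟩ := continuousAt_pertParams p r b c h₀
  obtain ⟨i0, i1⟩ := hh
  have lift : ∀ {f : ℝ × ℝ → ℝ} (t : ℝ), ContinuousAt f (0, h₀) →
      ContinuousAt (fun w : (ℝ × ℝ) × ℝ => f w.1) ((0, h₀), t) := fun t hf =>
    ContinuousAt.comp (x := (((0 : ℝ), h₀), t)) hf continuousAt_fst
  have hne : 1 + (pertParams p r b c ((0 : ℝ), h₀).1).X ≠ 0 := by simp
  have tR : ContinuousAt (fun v : ℝ × ℝ => timeR (pertParams p r b c v.1) v.2 (k₂ v)) (0, h₀) :=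
    continuousAt_saddleTime ((continuousAt_snd.sub pY).div (pX.const_add 1) hne)
      ((c₂.add pY).div (pX.const_add 1) hne) (by simpa using H₀.ratio₁)
      (by simpa [e₂] using H₀.ratio₂)
  have tL : ContinuousAt (fun v => timeL (k₃ v) (k₄ v)) (0, h₀) :=
    continuousAt_saddleTime (c₃.div_const 2) (c₄.div_const 2) (by simpa [e₃] using H₀.ratio₃)
      (by simpa [e₄] using H₀.ratio₄)
  have tC : ∀ {k k' : ℝ × ℝ → ℝ}, ContinuousAt k (0, h₀) → ContinuousAt k' (0, h₀) →
      ContinuousAt (fun v => timeC (k v) (k' v)) (0, h₀) := fun hk hk' =>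
    (continuousAt_const.sub (Real.continuous_arctan.continuousAt.comp hk)).sub
      (Real.continuous_arctan.continuousAt.comp hk')
  have aR : ∀ t, ContinuousAt (fun w : (ℝ × ℝ) × ℝ => arcR (pertParams p r b c w.1.1) w.1.2 w.2)
      ((0, h₀), t) := fun t => by
    have p1 := lift t pa
    have p2 := (lift t pX).const_add 1
    have p3 := lift t pY
    have p4 := ((lift t (f := fun v => v.2) continuousAt_snd).sub p3).div p2 hne
    exact (((lift t pX).const_add 2).sub
      (p2.mul (continuousAt_saddleX p1 p4 continuousAt_snd))).prodMk
      (p3.add (p2.mul (continuousAt_saddleY p1 p4 continuousAt_snd)))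
  have aL : ∀ t, ContinuousAt (fun w : (ℝ × ℝ) × ℝ => arcL (pertParams p r b c w.1.1) (k₃ w.1) w.2)
      ((0, h₀), t) := fun t => by
    have p1 := lift t pb
    have p2 := (lift t c₃).div_const 2
    have p3 := continuousAt_saddleX p1 p2 continuousAt_snd
    exact ((p3.const_mul 2).const_add (-3)).prodMk (continuousAt_const.sub
      ((p3.add (continuousAt_saddleY p1 p2 continuousAt_snd)).const_mul 2))
  have aC : ∀ {k : ℝ × ℝ → ℝ}, ContinuousAt k (0, h₀) → ∀ t,
      ContinuousAt (fun w : (ℝ × ℝ) × ℝ => arcC (pertParams p r b c w.1.1) (k w.1) w.2)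
      ((0, h₀), t) := fun {k} hk t => by
    have p1 := lift t pc
    have p2 := lift t hk
    have p3 : ContinuousAt (fun w : (ℝ × ℝ) × ℝ => w.2) ((0, h₀), t) := continuousAt_snd
    have p4 := (p1.mul p3).rexp
    have p5 := Real.continuous_cos.continuousAt.comp p3
    have p6 := Real.continuous_sin.continuousAt.comp p3
    exact (p4.mul (p5.sub (p2.mul p6))).prodMk (p4.mul (p6.add (p2.mul p5))).neg
  have him := fun {e h₁ h₂ h₃ h₄ h₅} (h : IsChain e h₁ h₂ h₃ h₄ h₅) => h.loop_spec.2.2.2.2.2.2.1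
  have posR : 0 < timeR ⟨0, 0, 0, 0, 0⟩ h₀ h₀ := saddleTime_pos H₀.ratio₁ H₀.ratio₂
  have posL : 0 < timeL h₀ h₀ := saddleTime_pos H₀.ratio₃ H₀.ratio₄
  have posC := (timeC_pos_lt i0 i0).1
  have s1 := eventually_image_subset_thickening (v₀ := (0, h₀))
    (Ψ := fun v t => arcR (pertParams p r b c v.1) v.2 t)
    (T := fun v => timeR (pertParams p r b c v.1) v.2 (k₂ v))
    (by simpa [e₂] using posR.le) aR tR hδ
  have s2 := eventually_image_subset_thickening (v₀ := (0, h₀))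
    (Ψ := fun v t => arcC (pertParams p r b c v.1) (k₂ v) t)
    (T := fun v => timeC (k₂ v) (k₃ v)) (by simpa [e₂, e₃] using posC.le) (aC c₂) (tC c₂ c₃) hδ
  have s3 := eventually_image_subset_thickening (v₀ := (0, h₀))
    (Ψ := fun v t => arcL (pertParams p r b c v.1) (k₃ v) t)
    (T := fun v => timeL (k₃ v) (k₄ v)) (by simpa [e₃, e₄] using posL.le) aL tL hδ
  have s4 := eventually_image_subset_thickening (v₀ := (0, h₀))
    (Ψ := fun v t => -arcC (pertParams p r b c v.1) (k₄ v) t)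
    (T := fun v => timeC (k₄ v) (k₅ v)) (by simpa [e₄, e₅] using posC.le)
    (fun t => (aC c₄ t).neg) (tC c₄ c₅) hδ
  filter_upwards [H, s1, s2, s3, s4] with v hv w1 w2 w3 w4
  rw [him hv, unperturbedOrbit, him H₀]
  simp only [pertParams_zero, e₂, e₃, e₄, e₅] at w1 w2 w3 w4
  refine union_subset (w1.trans (Metric.thickening_subset_of_subset _ ?_)) (union_subset
    (w2.trans (Metric.thickening_subset_of_subset _ ?_)) (union_subset
    (w3.trans (Metric.thickening_subset_of_subset _ ?_))
    (w4.trans (Metric.thickening_subset_of_subset _ ?_))))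
  · exact subset_union_left
  · exact subset_union_left.trans subset_union_right
  · exact subset_union_left.trans (subset_union_right.trans subset_union_right)
  · exact subset_union_right.trans (subset_union_right.trans subset_union_right)

/-! ### Limit cycles near sign changes of the Melnikov function -/

lemma eventually_lt_of_deriv_neg {f : ℝ → ℝ} {d x : ℝ} (hf : HasDerivAt f d x) (hd : d < 0) :
    ∀ᶠ t in 𝓝[>] x, f t < f x := by
  have h1 := hf.hasDerivWithinAt (s := Ioi x)
  rw [hasDerivWithinAt_iff_tendsto_slope' (by simp)] at h1
  filter_upwards [h1.eventually_lt_const hd, self_mem_nhdsWithin] with t ht htx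
  rw [slope_def_field, div_lt_iff₀ (sub_pos.2 htx), zero_mul] at ht
  linarith

lemma eventually_gt_of_deriv_pos {f : ℝ → ℝ} {d x : ℝ} (hf : HasDerivAt f d x) (hd : 0 < d) :
    ∀ᶠ t in 𝓝[>] x, f x < f t := by
  filter_upwards [eventually_lt_of_deriv_neg hf.neg (neg_neg_of_pos hd)] with t ht
  simpa using ht

/-- An isolated zero in an interval of a function that is analytic there and changes sign. -/
lemma exists_isolated_zero {f : ℝ → ℝ} {I : Set ℝ} (hI : OrdConnected I) (hIo : IsOpen I)
    (hf : AnalyticOnNhd ℝ f I) {x y : ℝ} (hx : x ∈ I) (hy : y ∈ I) (hfx : f x < 0) (hfy : 0 < f y) :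
    ∃ z, ∃ W : Set ℝ, z ∈ W ∧ IsOpen W ∧ W ⊆ I ∧ ∀ w ∈ W, f w = 0 ↔ w = z := by
  obtain ⟨z, hzI', hz⟩ : ∃ z ∈ uIcc x y, f z = 0 := by
    have hc : ContinuousOn f (uIcc x y) := fun t ht =>
      (hf t (hI.uIcc_subset hx hy ht)).continuousAt.continuousWithinAt
    have h0 : (0 : ℝ) ∈ uIcc (f x) (f y) := by
      rw [uIcc_of_le (by linarith)]; exact ⟨hfx.le, hfy.le⟩
    exact intermediate_value_uIcc hc h0
  have hzI := hI.uIcc_subset hx hy hzI'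
  have hiso : ∀ᶠ w in 𝓝[≠] z, f w ≠ 0 := by
    by_contra hcon
    have := hf.eqOn_zero_of_preconnected_of_frequently_eq_zero hI.isPreconnected hzI
      hcon
    exact hfx.ne (this hx)
  rw [eventually_nhdsWithin_iff] at hiso
  obtain ⟨W, hW, hWo, hzW⟩ := eventually_nhds_iff.1 (hiso.and (hIo.mem_nhds hzI))
  refine ⟨z, W, hzW, hWo, fun w hw => (hW w hw).2, fun w hw => ⟨fun h => ?_, fun h => h ▸ hz⟩⟩
  by_contra hne
  exact (hW w hw).1 hne h

/-- Near each sign change of the Melnikov function there are, for small `ε > 0`, limit cycles close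
to the unperturbed orbit. -/
theorem exists_isLimitCycle {h₀ : ℝ} (hh : h₀ ∈ Ioo (0 : ℝ) 1)
    (hneg : ∃ᶠ h in 𝓝 h₀, melnikov p r b c h < 0) (hpos : ∃ᶠ h in 𝓝 h₀, 0 < melnikov p r b c h)
    {δ : ℝ} (hδ : 0 < δ) {N : Set ℝ} (hN : N ∈ 𝓝 h₀) :
    ∀ᶠ ε in 𝓝[>] (0 : ℝ), ∃ Γ : Set (ℝ × ℝ), ∃ h ∈ N,
      IsLimitCycle (pertField scsHam (dilationPert p r b c) ε) Γ ∧ VisitsAllZones Γ ∧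
      Γ ⊆ Metric.thickening δ (unperturbedOrbit h₀) ∧ ((1 : ℝ), h) ∈ Γ ∧
      (1, h) ∈ upSection (pertField scsHam (dilationPert p r b c) ε) ∧
      ∀ z ∈ Γ, z ∈ upSection (pertField scsHam (dilationPert p r b c) ε) → z.2 = h := by
  obtain ⟨k₂, k₃, k₄, k₅, ⟨c₂, c₃, c₄, c₅⟩, hdiag, hchain⟩ := exists_chain p r b c hh
  have hclose := eventually_loop_subset_thickening p r b c hh c₂.continuousAt c₃.continuousAt
    c₄.continuousAt c₅.continuousAt hdiag.self_of_nhds hchain hδ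
  have han := c₅.analyticAt.eventually_analyticAt
  -- near `(0, h₀)` the return map is increasing in the initial height
  have hfd : ∀ᶠ v in 𝓝 ((0 : ℝ), h₀), 0 < fderiv ℝ k₅ v (0, 1) := by
    have h1 : ContinuousAt (fun v => fderiv ℝ k₅ v (0, 1)) (0, h₀) :=
      (c₅.analyticAt.fderiv.continuousAt).clm_apply continuousAt_const
    refine continuousAt_const.eventually_lt h1 ?_
    have h2 : HasDerivAt (fun h => k₅ (0, h)) (fderiv ℝ k₅ (0, h₀) (0, 1)) h₀ := by
      have := (c₅.differentiableAt (by simp)).hasFDerivAt.comp_hasDerivAt h₀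
        ((hasDerivAt_const h₀ (0 : ℝ)).prodMk (hasDerivAt_id h₀))
      exact this
    have h3 : HasDerivAt (fun h => k₅ (0, h)) 1 h₀ :=
      (hasDerivAt_id h₀).congr_of_eventuallyEq (hdiag.mono fun h hh => hh.2.2.2)
    rw [h2.unique h3]
    exact one_pos
  have hne : ∀ᶠ v in 𝓝 ((0 : ℝ), h₀), 1 - (v.1 * p) ^ 2 ≠ 0 := by
    have : ContinuousAt (fun v : ℝ × ℝ => 1 - (v.1 * p) ^ 2) (0, h₀) := by fun_prop
    exact this.eventually_ne (by simp)
  have hall := hchain.and (hclose.and (han.and (hfd.and hne)))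
  rw [nhds_prod_eq, eventually_prod_iff] at hall
  obtain ⟨pε, hpε, pI, hpI, hall⟩ := hall
  obtain ⟨η, hη, hηI⟩ := Metric.eventually_nhds_iff_ball.1 (hpI.and hN)
  rw [Real.ball_eq_Ioo] at hηI
  set I := Ioo (h₀ - η) (h₀ + η) with hI
  have hI₀ : I ∈ 𝓝 h₀ := Ioo_mem_nhds (by linarith) (by linarith)
  -- the first order expansion holds for initial heights near `h₀`
  have hder : ∀ᶠ h in 𝓝 h₀, HasDerivAt (fun ε => k₅ (ε, h)) (melnikov p r b c h / h) 0 := by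
    have ht : Tendsto (fun h : ℝ => ((0 : ℝ), h)) (𝓝 h₀) (𝓝 (0, h₀)) := by
      apply Continuous.tendsto; fun_prop
    have e : ∀ {k : ℝ × ℝ → ℝ}, ContDiffAt ℝ ω k (0, h₀) →
        ∀ᶠ h in 𝓝 h₀, ContDiffAt ℝ ω k (0, h) := fun hk =>
      (ht.eventually hk.analyticAt.eventually_analyticAt).mono fun _ h => h.contDiffAt
    filter_upwards [e c₂, e c₃, e c₄, e c₅, hdiag, ht.eventually hchain.eventually_nhds,
      isOpen_Ioo.mem_nhds hh] with h g2 g3 g4 g5 gd gc gh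
    exact hasDerivAt_return p r b c gh g2 g3 g4 g5 gd gc
  have hgood := hder.and (hdiag.and ((eventually_mem_set.2 hI₀).and
    (eventually_mem_set.2 (isOpen_Ioo.mem_nhds hh))))
  obtain ⟨x, hxM, hxd, hx0, hxI, hx⟩ := (hneg.and_eventually hgood).exists
  obtain ⟨y, hyM, hyd, hy0, hyI, hy⟩ := (hpos.and_eventually hgood).exists
  have hx' := eventually_lt_of_deriv_neg hxd (div_neg_of_neg_of_pos hxM hx.1)
  have hy' := eventually_gt_of_deriv_pos hyd (div_pos hyM hy.1)
  filter_upwards [hx', hy', nhdsWithin_le_nhds hpε] with ε hεx hεy hpε'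
  rw [hx0.2.2.2] at hεx
  rw [hy0.2.2.2] at hεy
  have hall' := fun h (hhI : h ∈ I) => hall hpε' (hηI h hhI).1
  have hinner : ∀ h : ℝ, HasDerivAt (fun h : ℝ => (ε, h)) ((0 : ℝ), (1 : ℝ)) h := fun h =>
    (hasDerivAt_const h ε).prodMk (hasDerivAt_id h)
  have hanI : AnalyticOnNhd ℝ (fun h => k₅ (ε, h) - h) I := fun h hhI => by
    have h1 : AnalyticAt ℝ (fun h : ℝ => (ε, h)) h := analyticAt_const.prod analyticAt_id
    exact (AnalyticAt.comp (hall' h hhI).2.2.1 h1).sub analyticAt_id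
  obtain ⟨z, W, hzW, hWo, hWI, hWz⟩ := exists_isolated_zero ordConnected_Ioo isOpen_Ioo hanI hxI hyI
    (by linarith) (by linarith)
  have hfix : ∀ h ∈ W, k₅ (ε, h) = h ↔ h = z := fun h hhW => by rw [← hWz h hhW, sub_eq_zero]
  have hmono : StrictMonoOn (fun h => k₅ (ε, h)) I := by
    have hd : ∀ h ∈ I, HasDerivAt (fun h => k₅ (ε, h)) (fderiv ℝ k₅ (ε, h) (0, 1)) h :=
      fun h hhI => (hall' h hhI).2.2.1.differentiableAt.hasFDerivAt.comp_hasDerivAt h (hinner h)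
    refine strictMonoOn_of_deriv_pos (convex_Ioo _ _)
      (fun h hhI => (hd h hhI).continuousAt.continuousWithinAt) fun h hhI => ?_
    have hhI' := interior_subset hhI
    rw [(hd h hhI').deriv]
    exact (hall' h hhI').2.2.2.1
  have hfield := pertField_eq (r := r) (b := b) (c := c) (hall' x hxI).2.2.2.2
  rw [hfield]
  have hret : IsReturnMap (dilationField (pertParams p r b c ε)) W (fun h => k₅ (ε, h)) := by
    refine ⟨fun h hhW => ?_, fun h hhW => ?_, fun h hhW => ?_⟩
    · have H := (hall' h (hWI hhW)).1
      obtain ⟨s1, s2, s3, s4, s5, s6, -⟩ := H.loop_spec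
      exact ⟨_, _, s1, s2, s3, s4, s5, s6⟩
    · have H := (hall' h (hWI hhW)).1
      exact (H.regular_right_up H.h₁_sub_gt H.h₁_sub_lt H.h₁_gt).2
    · have H := (hall' h (hWI hhW)).1
      exact (H.regular_right_up H.h₅_sub_gt H.h₅_sub_lt H.h₅_gt).2
  have hzI := hWI hzW
  have H := (hall' z hzI).1
  have hPz : k₅ (ε, z) = z := (hfix z hzW).2 rfl
  obtain ⟨s1, s2, s3, s4, s5, s6, -, s8⟩ := H.loop_spec
  replace s4 := s4.trans (congrArg (Prod.mk (1 : ℝ)) hPz)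
  refine ⟨_, z, (hηI z hzI).2, hret.isLimitCycle (exists_lipschitzWith_dilationField _) hWo
    (hmono.mono hWI).monotoneOn hzW hfix (by linarith) s2 s3 s4 s5 s6 ?_, s8,
    (hall' z hzI).2.1, ⟨0, ⟨le_rfl, by linarith⟩, s3⟩, hret.start_mem z hzW, ?_⟩
  · obtain ⟨_, ⟨t, ht, rfl⟩, htL⟩ := s8 .L
    refine ⟨t, ht, fun he => ?_⟩
    rw [he, s3] at htL
    have : (1 : ℝ) < -1 := htL
    norm_num at this
  · rintro _ ⟨t, ht, rfl⟩ hsec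
    rcases ht.1.eq_or_lt with h1 | h1
    · rw [← h1, s3]
    rcases ht.2.eq_or_lt with h2 | h2
    · rw [h2, s4]
    · exact absurd hsec (s6 t ⟨h1, h2⟩)

end limitCycles

/-! ### Choice of the coefficients -/

/-- Twice the inverse hyperbolic tangent. -/
noncomputable def logRatio (h : ℝ) : ℝ := Real.log (1 + h) - Real.log (1 - h)

/-- The remainder `2 h - (1 - h²) logRatio h = 4 h³ / 3 + O(h⁵)`. -/
noncomputable def cubicPart (h : ℝ) : ℝ := 2 * h - (1 - h ^ 2) * logRatio h

lemma hasDerivAt_logRatio {h : ℝ} (hh : h ∈ Ioo (-1 : ℝ) 1) :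
    HasDerivAt logRatio (2 / (1 - h ^ 2)) h := by
  have e1 : 1 + h ≠ 0 := by linarith [hh.1]
  have e2 : 1 - h ≠ 0 := by linarith [hh.2]
  have := (hasDerivAt_log_one_add (hasDerivAt_id h) (by simp; linarith [hh.1])).sub
    (hasDerivAt_log_one_sub (hasDerivAt_id h) (by simp; linarith [hh.2]))
  refine this.congr_deriv ?_
  have : 1 - h ^ 2 = (1 + h) * (1 - h) := by ring
  simp only [id, this]
  field_simp
  ring

lemma hasDerivAt_cubicPart {h : ℝ} (hh : h ∈ Ioo (-1 : ℝ) 1) :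
    HasDerivAt cubicPart (2 * h * logRatio h) h := by
  have e : 1 - h ^ 2 ≠ 0 := by nlinarith [hh.1, hh.2]
  have := ((hasDerivAt_id h).const_mul 2).sub
    (((hasDerivAt_pow 2 h).const_sub 1).mul (hasDerivAt_logRatio hh))
  refine this.congr_deriv ?_
  rw [mul_div_cancel₀ _ e]
  norm_num

lemma eventually_mem_Ioo_zero_one : ∀ᶠ h in 𝓝[>] (0 : ℝ), h ∈ Ioo (0 : ℝ) 1 :=
  Ioo_mem_nhdsGT one_pos

lemma tendsto_cubicPart_div : Tendsto (fun h => cubicPart h / h ^ 3) (𝓝[>] 0) (𝓝 (4 / 3)) := by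
  have hmem := eventually_mem_Ioo_zero_one
  have hd0 := hasDerivAt_cubicPart (h := 0) (by norm_num)
  have hl0 := hasDerivAt_logRatio (h := 0) (by norm_num)
  have l0 : logRatio 0 = 0 := by simp [logRatio]
  have c0 : cubicPart 0 = 0 := by simp [cubicPart, l0]
  refine HasDerivAt.lhopital_zero_nhdsGT (f' := fun h => 2 * h * logRatio h)
    (g' := fun h => 3 * h ^ 2) ?_ ?_ ?_ ?_ ?_ ?_
  · filter_upwards [hmem] with h hh using hasDerivAt_cubicPart ⟨by linarith [hh.1], hh.2⟩
  · exact Eventually.of_forall fun h => by simpa using hasDerivAt_pow 3 h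
  · filter_upwards [hmem] with h hh
    have := hh.1
    positivity
  · have := hd0.continuousAt.tendsto
    rw [c0] at this
    exact this.mono_left nhdsWithin_le_nhds
  · have : Tendsto (fun h : ℝ => h ^ 3) (𝓝 0) (𝓝 (0 ^ 3)) := by
      apply Continuous.tendsto; fun_prop
    simpa using this.mono_left nhdsWithin_le_nhds
  · have h1 := hl0.hasDerivWithinAt (s := Ioi 0)
    rw [hasDerivWithinAt_iff_tendsto_slope' (by simp)] at h1
    have h2 := h1.const_mul (2 / 3)
    norm_num at h2
    refine h2.congr' ?_
    filter_upwards [hmem] with h hh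
    have := hh.1.ne'
    rw [slope_def_field, l0]
    field_simp
    simp

/-- The combination of `cubicPart h` and `cubicPart (h / 2)` without cubic term. -/
noncomputable def quinticPart (h : ℝ) : ℝ := cubicPart h / 8 - cubicPart (h / 2)

lemma quinticPart_pos {h : ℝ} (hh : h ∈ Ioo (0 : ℝ) 1) : 0 < quinticPart h := by
  have hd : ∀ x ∈ Ico (0 : ℝ) 1, HasDerivAt quinticPart
      (x / 4 * (logRatio x - 2 * logRatio (x / 2))) x := fun x hx => by
    have h1 := (hasDerivAt_cubicPart (h := x) ⟨by linarith [hx.1], hx.2⟩).div_const 8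
    have h2 := (hasDerivAt_cubicPart (h := x / 2) ⟨by linarith [hx.1], by linarith [hx.2]⟩).comp x
      ((hasDerivAt_id x).div_const 2)
    refine (h1.sub h2).congr_deriv ?_
    ring
  have hmono : StrictMonoOn quinticPart (Ico 0 1) := by
    refine strictMonoOn_of_deriv_pos (convex_Ico _ _)
      (fun x hx => (hd x hx).continuousAt.continuousWithinAt) fun x hx => ?_
    rw [interior_Ico] at hx
    rw [(hd x (Ioo_subset_Ico_self hx)).deriv]
    obtain ⟨x0, x1⟩ := hx
    refine mul_pos (by linarith) ?_
    -- `(1 + x) (1 - x/2)² > (1 - x) (1 + x/2)²`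
    have key : Real.log ((1 - x) * (1 + x / 2) ^ 2) < Real.log ((1 + x) * (1 - x / 2) ^ 2) := by
      refine Real.log_lt_log (mul_pos (by linarith) (pow_pos (by linarith) 2)) ?_
      nlinarith [pow_pos x0 3]
    rw [Real.log_mul (by linarith) (pow_ne_zero _ (by linarith)), Real.log_pow,
      Real.log_mul (by linarith) (pow_ne_zero _ (by linarith)), Real.log_pow] at key
    push_cast at key
    simp only [logRatio]
    linarith
  have := hmono ⟨le_rfl, one_pos⟩ (Ioo_subset_Ico_self hh) hh.1
  simpa [quinticPart, cubicPart, logRatio] using this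

/-- The coefficient function of the central dilation. -/
noncomputable def centralPart (h : ℝ) : ℝ := (1 + h ^ 2) * (Real.pi - 2 * Real.arctan h)

/-- Every combination of the functions `quinticPart`, `cubicPart`, `h` and `centralPart` is the
Melnikov function of some perturbation. -/
lemma melnikov_eq (μ₁ μ₂ μ₃ μ₄ h : ℝ) :
    melnikov (μ₃ + μ₄ / 8) ((μ₂ + 2 * (μ₃ + μ₄ / 8) - μ₄) / 2) (-μ₄ / 4) (μ₁ / 2) h =
      μ₄ * quinticPart h + μ₃ * cubicPart h + μ₂ * h + μ₁ * centralPart h := by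
  simp only [melnikov, quinticPart, cubicPart, logRatio, centralPart]
  ring

lemma isLittleO_id_centralPart : (fun h : ℝ => h) =o[𝓝[>] 0] centralPart := by
  have hc : Tendsto centralPart (𝓝[>] 0) (𝓝 Real.pi) := by
    have : Continuous centralPart := by
      have := Real.continuous_arctan
      unfold centralPart
      fun_prop
    have h1 := this.tendsto 0
    simp only [centralPart, Real.arctan_zero] at h1
    norm_num at h1
    exact h1.mono_left nhdsWithin_le_nhds
  refine isLittleO_of_tendsto' ?_ ?_
  · filter_upwards [hc.eventually_ne Real.pi_ne_zero] with h hh h0 using absurd h0 hh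
  · have : Tendsto (fun h : ℝ => h) (𝓝[>] 0) (𝓝 0) := tendsto_id.mono_left nhdsWithin_le_nhds
    have h1 := this.div hc Real.pi_ne_zero
    rw [zero_div] at h1
    exact h1

lemma centralPart_pos (h : ℝ) : 0 < centralPart h := by
  have := Real.arctan_lt_pi_div_two h
  exact mul_pos (by positivity) (by linarith)

lemma cubicPart_isTheta : cubicPart =Θ[𝓝[>] 0] fun h => h ^ 3 := by
  have hne : ∀ᶠ h in 𝓝[>] (0 : ℝ), h ^ 3 ≠ 0 := by
    filter_upwards [eventually_mem_Ioo_zero_one] with h hh using pow_ne_zero _ hh.1.ne'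
  have := (isEquivalent_const_iff_tendsto (by norm_num : (4 / 3 : ℝ) ≠ 0)).2 tendsto_cubicPart_div
  have h2 := (this.mul (IsEquivalent.refl (u := fun h : ℝ => h ^ 3))).isTheta
  have h3 : (fun h => cubicPart h / h ^ 3) * (fun h : ℝ => h ^ 3) =ᶠ[𝓝[>] 0] cubicPart := by
    filter_upwards [hne] with h hh
    simp [div_mul_cancel₀ _ hh]
  refine (h3.symm.isTheta).trans (h2.trans ?_)
  exact (isTheta_const_mul_left (by norm_num : (4 / 3 : ℝ) ≠ 0)).2 (isTheta_refl _ _)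

lemma isLittleO_cubicPart_id : cubicPart =o[𝓝[>] 0] fun h : ℝ => h := by
  refine cubicPart_isTheta.1.trans_isLittleO ?_
  have : (fun h : ℝ => h ^ 3) =o[𝓝 0] fun h : ℝ => h ^ 1 :=
    isLittleO_pow_pow (by norm_num)
  simpa using this.mono nhdsWithin_le_nhds

lemma isLittleO_quinticPart_cubicPart : quinticPart =o[𝓝[>] 0] cubicPart := by
  refine IsLittleO.trans_isTheta ?_ cubicPart_isTheta.symm
  have hmem := eventually_mem_Ioo_zero_one
  refine isLittleO_of_tendsto' ?_ ?_
  · filter_upwards [hmem] with h hh h0 using absurd h0 (pow_ne_zero _ hh.1.ne')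
  · have hhalf : Tendsto (fun h : ℝ => h / 2) (𝓝[>] 0) (𝓝[>] 0) := by
      refine tendsto_nhdsWithin_iff.2 ⟨?_, ?_⟩
      · have : Tendsto (fun h : ℝ => h / 2) (𝓝 0) (𝓝 (0 / 2)) := by
          apply Continuous.tendsto; fun_prop
        rw [zero_div] at this
        exact this.mono_left nhdsWithin_le_nhds
      · filter_upwards [hmem] with h hh using half_pos hh.1
    have h1 := (tendsto_cubicPart_div.div_const 8).sub
      ((tendsto_cubicPart_div.comp hhalf).div_const 8)
    rw [sub_self] at h1
    refine h1.congr' ?_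
    filter_upwards [hmem] with h hh
    have := hh.1.ne'
    simp only [Function.comp, quinticPart]
    field_simp
    norm_num

lemma cubicPart_pos : ∀ᶠ h in 𝓝[>] (0 : ℝ), 0 < cubicPart h := by
  filter_upwards [tendsto_cubicPart_div.eventually_const_lt (by norm_num : (0 : ℝ) < 4 / 3),
    eventually_mem_Ioo_zero_one] with h hh h0
  exact (div_pos_iff_of_pos_right (pow_pos h0.1 3)).1 hh

lemma eventually_add_mul_pos {f g : ℝ → ℝ} (hfg : f =o[𝓝[>] 0] g)
    (hg : ∀ᶠ h in 𝓝[>] (0 : ℝ), 0 < g h) {μ : ℝ} (hμ : 0 < μ) :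
    ∀ᶠ h in 𝓝[>] (0 : ℝ), 0 < f h + μ * g h := by
  filter_upwards [hfg.def (half_pos hμ), hg] with h h1 h2
  rw [Real.norm_eq_abs, Real.norm_eq_abs, abs_of_pos h2] at h1
  have := neg_abs_le (f h)
  nlinarith

lemma eventually_add_mul_neg {f g : ℝ → ℝ} (hfg : f =o[𝓝[>] 0] g)
    (hg : ∀ᶠ h in 𝓝[>] (0 : ℝ), 0 < g h) {μ : ℝ} (hμ : μ < 0) :
    ∀ᶠ h in 𝓝[>] (0 : ℝ), f h + μ * g h < 0 := by
  filter_upwards [eventually_add_mul_pos hfg.neg_left hg (neg_pos.2 hμ)] with h hh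
  linarith

lemma eventually_coeff_pos {a : ℝ} (ha : 0 < a) (d : ℝ) : ∀ᶠ μ in 𝓝 (0 : ℝ), 0 < a + μ * d := by
  have : ContinuousAt (fun μ : ℝ => a + μ * d) 0 := by fun_prop
  exact continuousAt_const.eventually_lt this (by simpa using ha)

lemma eventually_coeff_neg {a : ℝ} (ha : a < 0) (d : ℝ) : ∀ᶠ μ in 𝓝 (0 : ℝ), a + μ * d < 0 := by
  have : ContinuousAt (fun μ : ℝ => a + μ * d) 0 := by fun_prop
  exact this.eventually_lt continuousAt_const (by simpa using ha)

/-- Since the functions spanning the possible Melnikov functions have different orders of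
magnitude at `0`, coefficients of decreasing size and alternating signs produce three sign
changes. -/
theorem exists_melnikov_alternating : ∃ p r b c x₀ x₁ x₂ x₃ : ℝ, 0 < x₀ ∧ x₀ < x₁ ∧ x₁ < x₂ ∧
    x₂ < x₃ ∧ x₃ < 1 ∧ melnikov p r b c x₀ < 0 ∧ 0 < melnikov p r b c x₁ ∧
    melnikov p r b c x₂ < 0 ∧ 0 < melnikov p r b c x₃ := by
  have small : ∀ {x : ℝ}, 0 < x → ∀ᶠ y in 𝓝[>] (0 : ℝ), y ∈ Ioo 0 x := fun hx => Ioo_mem_nhdsGT hx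
  have o₁ := isLittleO_id_centralPart
  have o₂ := isLittleO_cubicPart_id
  have o₃ := isLittleO_quinticPart_cubicPart
  have hx₃ : (1 / 2 : ℝ) ∈ Ioo (0 : ℝ) 1 := by norm_num
  have q₃ := quinticPart_pos hx₃
  set x₃ : ℝ := 1 / 2
  -- the coefficient of `quinticPart` is `1`; each further coefficient is chosen so small that it
  -- keeps the signs already obtained, and it dictates the sign at a point closer to `0`
  have neg0 : ∀ᶠ μ in 𝓝[<] (0 : ℝ), μ < 0 := self_mem_nhdsWithin
  have pos0 : ∀ᶠ μ in 𝓝[>] (0 : ℝ), 0 < μ := self_mem_nhdsWithin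
  obtain ⟨μ₃, hμ₃, a₃⟩ := (neg0.and ((eventually_coeff_pos q₃ (cubicPart x₃)).filter_mono
    nhdsWithin_le_nhds)).exists
  obtain ⟨x₂, a₂, hx₂⟩ := ((eventually_add_mul_neg o₃ cubicPart_pos hμ₃).and (small hx₃.1)).exists
  obtain ⟨μ₂, hμ₂, b₃, b₂⟩ := (pos0.and (((eventually_coeff_pos a₃ x₃).filter_mono
    nhdsWithin_le_nhds).and
    ((eventually_coeff_neg a₂ x₂).filter_mono
    nhdsWithin_le_nhds))).exists
  have o₂' : (fun h => quinticPart h + μ₃ * cubicPart h) =o[𝓝[>] 0] fun h : ℝ => h :=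
    (o₃.trans o₂).add (o₂.const_mul_left μ₃)
  obtain ⟨x₁, b₁, hx₁⟩ := ((eventually_add_mul_pos o₂' pos0 hμ₂).and (small hx₂.1)).exists
  obtain ⟨μ₁, hμ₁, c₃, c₂, c₁⟩ := (neg0.and (((eventually_coeff_pos b₃ (centralPart x₃)).filter_mono
    nhdsWithin_le_nhds).and (((eventually_coeff_neg b₂ (centralPart x₂)).filter_mono
    nhdsWithin_le_nhds).and ((eventually_coeff_pos b₁ (centralPart x₁)).filter_mono
    nhdsWithin_le_nhds)))).exists
  have o₁' : (fun h => quinticPart h + μ₃ * cubicPart h + μ₂ * h) =o[𝓝[>] 0] centralPart :=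
    (o₂'.trans o₁).add (o₁.const_mul_left μ₂)
  obtain ⟨x₀, c₀, hx₀⟩ := ((eventually_add_mul_neg o₁'
    (Eventually.of_forall centralPart_pos) hμ₁).and (small hx₁.1)).exists
  have key := melnikov_eq μ₁ μ₂ μ₃ 1
  simp only [one_mul] at key
  refine ⟨μ₃ + 1 / 8, (μ₂ + 2 * (μ₃ + 1 / 8) - 1) / 2, -1 / 4, μ₁ / 2, x₀, x₁, x₂, x₃,
    hx₀.1, hx₀.2, hx₁.2, hx₂.2, hx₃.2, ?_⟩
  rw [key, key, key, key]
  exact ⟨c₀, c₁, c₂, c₃⟩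

lemma analyticOnNhd_melnikov (p r b c : ℝ) : AnalyticOnNhd ℝ (melnikov p r b c) (Ioo 0 1) := by
  rintro h ⟨h0, h1⟩
  refine ContDiffAt.analyticAt ?_
  have ha : ContDiffAt ℝ ω Real.arctan h := Real.contDiff_arctan.contDiffAt
  have l1 : ContDiffAt ℝ ω (fun h => Real.log (1 + h)) h := by
    fun_prop (disch := linarith)
  have l2 : ContDiffAt ℝ ω (fun h => Real.log (1 - h)) h := by
    fun_prop (disch := linarith)
  have l3 : ContDiffAt ℝ ω (fun h => Real.log (1 + h / 2)) h := by
    fun_prop (disch := linarith)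
  have l4 : ContDiffAt ℝ ω (fun h => Real.log (1 - h / 2)) h := by
    fun_prop (disch := linarith)
  have q1 : ContDiffAt ℝ ω (fun h : ℝ => 1 - h ^ 2) h := by fun_prop
  have q2 : ContDiffAt ℝ ω (fun h : ℝ => 1 - (h / 2) ^ 2) h := by fun_prop
  have q3 : ContDiffAt ℝ ω (fun h : ℝ => 2 * r * h) h := by fun_prop
  have q4 : ContDiffAt ℝ ω (fun h : ℝ => 1 + h ^ 2) h := by fun_prop
  exact ((q3.sub (contDiffAt_const.mul (q1.mul (l1.sub l2)))).sub
    (contDiffAt_const.mul (q2.mul (l3.sub l4)))).add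
    (contDiffAt_const.mul (q4.mul (contDiffAt_const.sub (contDiffAt_const.mul ha))))

/-- A function analytic on an interval which is negative at `x` and positive at `y > x` changes
sign at some point in between. -/
lemma exists_sign_change {f : ℝ → ℝ} {I : Set ℝ} (hI : OrdConnected I) (hf : AnalyticOnNhd ℝ f I)
    {x y : ℝ} (hx : x ∈ I) (hy : y ∈ I) (hxy : x < y) (hfx : f x < 0) (hfy : 0 < f y) :
    ∃ z ∈ Ioo x y, (∃ᶠ t in 𝓝 z, f t < 0) ∧ ∃ᶠ t in 𝓝 z, 0 < f t := by
  set S := {t | t ∈ Icc x y ∧ f t < 0} with hS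
  have hSne : S.Nonempty := ⟨x, ⟨le_rfl, hxy.le⟩, hfx⟩
  have hSb : BddAbove S := ⟨y, fun t ht => ht.1.2⟩
  set z := sSup S with hz
  have hxz : x ≤ z := le_csSup hSb ⟨⟨le_rfl, hxy.le⟩, hfx⟩
  have hzy : z ≤ y := csSup_le hSne fun t ht => ht.1.2
  have hzI : z ∈ I := hI.out hx hy ⟨hxz, hzy⟩
  have hneg : ∃ᶠ t in 𝓝 z, f t < 0 := by
    have := mem_closure_iff_frequently.1 (csSup_mem_closure hSne hSb)
    exact this.mono fun t ht => ht.2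
  have hcont := (hf z hzI).continuousAt
  have hz0 : f z = 0 := by
    refine le_antisymm ?_ ?_
    · by_contra! h
      have := hcont.eventually (lt_mem_nhds h)
      obtain ⟨t, h1, h2⟩ := (hneg.and_eventually this).exists
      linarith
    · by_contra! h
      have hlt : z < y := lt_of_le_of_ne hzy fun h' => by rw [h'] at h; linarith
      have h1 : ∀ᶠ t in 𝓝[>] z, f t < 0 := nhdsWithin_le_nhds (hcont.eventually (gt_mem_nhds h))
      obtain ⟨t, h2, h3⟩ := (h1.and (Ioo_mem_nhdsGT hlt)).exists
      exact absurd (le_csSup hSb ⟨⟨hxz.trans h3.1.le, h3.2.le⟩, h2⟩) (not_le.2 h3.1)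
  have hxz' : x < z := lt_of_le_of_ne hxz fun h => by rw [h] at hfx; linarith
  have hzy' : z < y := lt_of_le_of_ne hzy fun h => by rw [← h] at hfy; linarith
  refine ⟨z, ⟨hxz', hzy'⟩, hneg, ?_⟩
  by_contra hcon
  rw [not_frequently] at hcon
  -- otherwise `f` vanishes to the right of `z`
  have h0 : ∀ᶠ t in 𝓝[>] z, f t = 0 := by
    filter_upwards [nhdsWithin_le_nhds hcon, Ioo_mem_nhdsGT hzy'] with t h1 h2
    refine le_antisymm (not_lt.1 h1) (not_lt.1 fun h3 => ?_)
    exact absurd (le_csSup hSb ⟨⟨hxz.trans h2.1.le, h2.2.le⟩, h3⟩) (not_le.2 h2.1)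
  have h1 : ∃ᶠ t in 𝓝[≠] z, f t = 0 :=
    h0.frequently.filter_mono (nhdsWithin_mono z fun t ht => ne_of_gt ht)
  exact hfx.ne (hf.eqOn_zero_of_preconnected_of_frequently_eq_zero hI.isPreconnected hzI h1 hx)

lemma exists_sign_change' {f : ℝ → ℝ} {I : Set ℝ} (hI : OrdConnected I)
    (hf : AnalyticOnNhd ℝ f I) {x y : ℝ} (hx : x ∈ I) (hy : y ∈ I) (hxy : x < y) (hfx : 0 < f x)
    (hfy : f y < 0) : ∃ z ∈ Ioo x y, (∃ᶠ t in 𝓝 z, f t < 0) ∧ ∃ᶠ t in 𝓝 z, 0 < f t := by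
  obtain ⟨z, hz, h1, h2⟩ := exists_sign_change hI hf.neg hx hy hxy
    (by simpa using hfx) (by simpa using hfy)
  exact ⟨z, hz, h2.mono fun t ht => by simpa using ht, h1.mono fun t ht => by simpa using ht⟩

/-- The loops of the unperturbed system are crossing periodic orbits through all zones. -/
lemma unperturbedOrbit_spec {h : ℝ} (hh : h ∈ Ioo (0 : ℝ) 1) :
    IsCrossingPeriodicOrbit (hamField scsHam) (unperturbedOrbit h) ∧
      VisitsAllZones (unperturbedOrbit h) ∧ ((1 : ℝ), h) ∈ unperturbedOrbit h := by
  have hfield : hamField scsHam = dilationField ⟨0, 0, 0, 0, 0⟩ := by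
    funext Z z; exact hamField_eq Z z
  obtain ⟨s1, s2, s3, s4, s5, -, -, s8⟩ := (isChain_zero hh).loop_spec
  have hT : 0 < loopTime ⟨0, 0, 0, 0, 0⟩ h h h h h := by linarith
  have hcl := s4.trans s3.symm
  rw [hfield]
  refine ⟨⟨⟨_, _, hT, s2.isTrajectory_periodize hT hcl, periodize_add _ hT, ?_,
    (range_periodize hT hcl).symm⟩, ?_⟩, s8, 0, ⟨le_rfl, hT.le⟩, s3⟩
  · obtain ⟨_, ⟨t, ht, rfl⟩, htL⟩ := s8 .L
    refine ⟨t, fun he => ?_⟩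
    rw [periodize_eqOn hT hcl ht, periodize_eqOn hT hcl ⟨le_rfl, hT.le⟩, s3] at he
    rw [he] at htL
    have : (1 : ℝ) < -1 := htL
    norm_num at this
  · rintro _ ⟨t, ht, rfl⟩ hz
    exact mem_crossingSet_of_regular (s5 t ht) hz

end PiecewiseHam

theorem mainTheorem7 :
    ∃ L : ℝ → Set (ℝ × ℝ),
      (∀ h ∈ Set.Ioo (0 : ℝ) 1,
        PiecewiseHam.IsCrossingPeriodicOrbit (PiecewiseHam.hamField PiecewiseHam.scsHam) (L h) ∧
          PiecewiseHam.VisitsAllZones (L h) ∧ ((1 : ℝ), h) ∈ L h) ∧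
      ∃ (P : PiecewiseHam.Zone → PiecewiseHam.AffinePert) (h : Fin 3 → ℝ),
        StrictMono h ∧ (∀ i, h i ∈ Set.Ioo (0 : ℝ) 1) ∧
        ∀ δ > (0 : ℝ), ∃ ε₀ > (0 : ℝ), ∀ ε ∈ Set.Ioo (0 : ℝ) ε₀,
          ∃ Γ : Fin 3 → Set (ℝ × ℝ), Function.Injective Γ ∧
            ∀ i, PiecewiseHam.IsLimitCycle
                (PiecewiseHam.pertField PiecewiseHam.scsHam P ε) (Γ i) ∧
              PiecewiseHam.VisitsAllZones (Γ i) ∧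
              Γ i ⊆ Metric.thickening δ (L (h i)) := by
  open PiecewiseHam Filter Topology in
  refine ⟨unperturbedOrbit, fun h hh => unperturbedOrbit_spec hh, ?_⟩
  obtain ⟨p, r, b, c, x₀, x₁, x₂, x₃, i0, i1, i2, i3, i4, s0, s1, s2, s3⟩ :=
    exists_melnikov_alternating
  have han := analyticOnNhd_melnikov p r b c
  have m₀ : x₀ ∈ Ioo (0 : ℝ) 1 := ⟨i0, by linarith⟩
  have m₁ : x₁ ∈ Ioo (0 : ℝ) 1 := ⟨by linarith, by linarith⟩
  have m₂ : x₂ ∈ Ioo (0 : ℝ) 1 := ⟨by linarith, by linarith⟩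
  have m₃ : x₃ ∈ Ioo (0 : ℝ) 1 := ⟨by linarith, i4⟩
  obtain ⟨z₁, hz₁, n₁⟩ := exists_sign_change ordConnected_Ioo han m₀ m₁ i1 s0 s1
  obtain ⟨z₂, hz₂, n₂⟩ := exists_sign_change' ordConnected_Ioo han m₁ m₂ i2 s1 s2
  obtain ⟨z₃, hz₃, n₃⟩ := exists_sign_change ordConnected_Ioo han m₂ m₃ i3 s2 s3
  have g₁ : z₁ ∈ Ioo (0 : ℝ) 1 := ⟨m₀.1.trans hz₁.1, hz₁.2.trans m₁.2⟩
  have g₂ : z₂ ∈ Ioo (0 : ℝ) 1 := ⟨m₁.1.trans hz₂.1, hz₂.2.trans m₂.2⟩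
  have g₃ : z₃ ∈ Ioo (0 : ℝ) 1 := ⟨m₂.1.trans hz₃.1, hz₃.2.trans m₃.2⟩
  refine ⟨dilationPert p r b c, ![z₁, z₂, z₃], ?_, ?_, fun δ hδ => ?_⟩
  · rw [Fin.strictMono_iff_lt_succ]
    intro i
    fin_cases i
    · exact hz₁.2.trans hz₂.1
    · exact hz₂.2.trans hz₃.1
  · intro i
    fin_cases i
    · exact g₁
    · exact g₂
    · exact g₃
  have e₁ := exists_isLimitCycle p r b c g₁ n₁.1 n₁.2 hδ (isOpen_Ioo.mem_nhds hz₁)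
  have e₂ := exists_isLimitCycle p r b c g₂ n₂.1 n₂.2 hδ (isOpen_Ioo.mem_nhds hz₂)
  have e₃ := exists_isLimitCycle p r b c g₃ n₃.1 n₃.2 hδ (isOpen_Ioo.mem_nhds hz₃)
  obtain ⟨ε₀, hε₀, hsub⟩ := mem_nhdsGT_iff_exists_Ioo_subset.1 (e₁.and (e₂.and e₃))
  refine ⟨ε₀, hε₀, fun ε hε => ?_⟩
  obtain ⟨⟨Γ₁, y₁, w₁, l₁, v₁, t₁, -, u₁, q₁⟩, ⟨Γ₂, y₂, w₂, l₂, v₂, t₂, p₂, u₂, q₂⟩,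
    Γ₃, y₃, w₃, l₃, v₃, t₃, p₃, u₃, q₃⟩ := hsub hε
  refine ⟨![Γ₁, Γ₂, Γ₃], ?_, ?_⟩
  · -- the orbits meet the section `x = 1` at different heights
    have h12 : Γ₁ ≠ Γ₂ := fun h => by
      have : y₂ = y₁ := q₁ _ (h ▸ p₂) u₂
      linarith [w₁.2, w₂.1]
    have h13 : Γ₁ ≠ Γ₃ := fun h => by
      have : y₃ = y₁ := q₁ _ (h ▸ p₃) u₃
      linarith [w₁.2, w₃.1]
    have h23 : Γ₂ ≠ Γ₃ := fun h => by
      have : y₃ = y₂ := q₂ _ (h ▸ p₃) u₃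
      linarith [w₂.2, w₃.1]
    intro i j hij
    fin_cases i <;> fin_cases j <;> simp_all [eq_comm]
  · intro i
    fin_cases i
    · exact ⟨l₁, v₁, t₁⟩
    · exact ⟨l₂, v₂, t₂⟩
    · exact ⟨l₃, v₃, t₃⟩
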